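/- **Theorem.** Let $P=\{p_1,\dots,p_n\}$ and $S=\{s_1,\dots,s_m\}$ be finite families of non-degenerate line segments in the Euclidean plane, each of total length $1$, with mass distributed along the segments with density one with respect to arc length. Let $\mathrm{EMD}$ be the infimum of the costs $\|\tau\|=\int d(x,y)\,\mathrm d\tau(x,y)$ of all transport plans $\tau$ between these two mass distributions. (1) *Construction.* Let $0<\delta\le 1$. Match pieces of $P$ with pieces of $S$ of the same total length by a transport plan $\tau_M$ that moves mass over distance at most $\delta/(nm)$ only (for instance greedily, until no further pieces can be matched). Subdivide the remaining parts of $P$ and $S$ into finite families $Q$ and $R$ of segments such that, for all $q\in Q$, $r\in R$, the longest distance between a point of $q$ and a point of $r$ is at most $1+\delta$ times the shortest. Choose a point on every $q\in Q$ and on every $r\in R$, weighted with the length of the piece, let $\nu$ be an optimal transport plan between these weighted points, and let $\tau_G$ arise from $\nu$ by spreading the mass moved between two points evenly over the two pieces on which they were chosen. There is an absolute constant $C_0$ such that this can be carried out with $|Q|+|R|\le C_0\,nm/\delta^2$; and whenever it is carried out, $\tau=\tau_M+\tau_G$ is a transport plan between $P$ and $S$ with $$\|\tau\|\le(1+3\delta)\,\mathrm{EMD}+\frac{5\delta}{nm}.$$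 (2) *Algorithm.* The model of computation is a real RAM with registers and arrays of natural and of real numbers, unit-cost arithmetic ($+,-$ on naturals, $+,-,\times,/,\sqrt{\ }$ on reals), comparisons, indirect addressing, and independent uniform random numbers from $[0,1]$; the output of a transport plan costs one unit for each of its entries. There are absolute constants $c',C$, constants $K_D$ that depend on $D\in\mathbb R$ only, and a map that assigns to each program $A$ a program $B_A$, such that the following holds. Let $\delta>0$, let $f_\delta:\mathbb N\to\mathbb R$ be non-decreasing and $\rho:\mathbb N\to[0,\infty]$ non-increasing, and suppose that for all pairs of finite families of positively weighted points in the plane, of equal total weight and with $k$ points altogether (both families non-empty), $A$ (given the points, the weights and $\delta$) constructs in time at most $f_\delta(k)$ a transport plan of cost at most $1+\delta$ times the optimum, except with probability at most $\rho(k)$. Then for all $P,S$ as above, $B_A$ (given the end points of the segments and $\delta$) constructs, except with probability at most $\rho(n+m)$, a transport plan between $P$ and $S$, given as a list of pairs of segments with the mass that is moved, evenly spread, from the first to the second, of cost at most $$(1+c'\delta)\,\mathrm{EMD}+\frac{5\delta}{nm}$$ in time at most $C\,f_\delta\!\left(\left\lceil C\,nm/\min(1,\delta)^2\right\rceil\right)$;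 and if $f_\delta(2k)\le D f_\delta(k)$ for all $k\ge1$, also in time at most $K_D\,f_\delta\!\left(\left\lceil nm/\min(1,\delta)^2\right\rceil\right)$. (For $\delta\le1$ this is the bound $O(f_\delta(nm/\delta^2))$.) -/

import Mathlib

open MeasureTheory
open scoped ENNReal

noncomputable section

/-! ### Segments, length measures, transport plans -/

/-- The plane with the Euclidean metric. -/
abbrev Plane := EuclideanSpace ℝ (Fin 2)

/-- A line segment in the plane, given by its two end points. -/
structure Seg where
  a : Plane
  b : Plane

namespace Seg

/-- Length of a segment. -/
def len (s : Seg) : ℝ := dist s.a s.b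

/-- The set of points of a segment. -/
def carrier (s : Seg) : Set Plane := segment ℝ s.a s.b

/-- The uniform probability measure on a segment. -/
def unif (s : Seg) : Measure Plane :=
  (volume.restrict (Set.Icc (0 : ℝ) 1)).map (fun t => AffineMap.lineMap s.a s.b t)

end Seg

/-- The mass distribution of a finite family of segments: mass is spread over every segment with
density one with respect to arc length. -/
def lengthMeasure {n : ℕ} (P : Fin n → Seg) : Measure Plane :=
  ∑ i, ENNReal.ofReal (P i).len • (P i).unif

/-- `π` is a transport plan from the mass distribution `μ` to the mass distribution `ν`:
`π (A ×ˢ B)` is the mass moved from `A` to `B`. -/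
def IsTransportPlan (μ ν : Measure Plane) (π : Measure (Plane × Plane)) : Prop :=
  π.fst = μ ∧ π.snd = ν

/-- The cost of a transport plan: mass times the Euclidean distance over which it is moved. -/
def planCost (π : Measure (Plane × Plane)) : ℝ≥0∞ := ∫⁻ z, edist z.1 z.2 ∂π

/-- The earth mover's distance: the infimum of the costs of all transport plans. -/
def emd (μ ν : Measure Plane) : ℝ≥0∞ :=
  ⨅ (π : Measure (Plane × Plane)) (_ : IsTransportPlan μ ν π), planCost π

/-! ### Transport between weighted points -/

/-- `w i j` is the mass moved from point `i` (of weight `a i`) to point `j` (of weight `b j`). -/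
structure IsDiscretePlan {k l : ℕ} (a : Fin k → ℝ) (b : Fin l → ℝ)
    (w : Fin k → Fin l → ℝ) : Prop where
  nonneg : ∀ i j, 0 ≤ w i j
  row : ∀ i, ∑ j, w i j = a i
  col : ∀ j, ∑ i, w i j = b j

/-- Cost of a transport plan between the points `x i` and the points `y j`. -/
def discreteCost {k l : ℕ} (x : Fin k → Plane) (y : Fin l → Plane)
    (w : Fin k → Fin l → ℝ) : ℝ :=
  ∑ i, ∑ j, w i j * dist (x i) (y j)

/-- The mass `w q r` is spread evenly over the segments `Q q` and `R r`. -/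
def spread {k l : ℕ} (Q : Fin k → Seg) (R : Fin l → Seg) (w : Fin k → Fin l → ℝ) :
    Measure (Plane × Plane) :=
  ∑ q, ∑ r, ENNReal.ofReal (w q r) • (Q q).unif.prod (R r).unif

/-! ### The match-and-subdivide construction -/

/-- A run of the construction on the segment families `P` and `S`.  Pieces `M` of `P` are matched
to pieces `M'` of `S` over distances at most `δ / (n m)`; what is left over of `P` and `S` is
subdivided into `Q` and `R` such that for all `q`, `r` the longest distance between the two pieces
is at most `1 + δ` times the shortest; a point is chosen on every piece of `Q` and `R`, weighted by
the length of the piece; and `ν` is an optimal transport plan between these weighted points.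
(When the greedy matching has stopped, the pieces left over have pairwise distance at least
`δ / (n m)`; this is not required here, so runs with any matching are allowed.) -/
structure MatchSubdivide (δ : ℝ) {n m : ℕ} (P : Fin n → Seg) (S : Fin m → Seg) where
  numM : ℕ
  numM' : ℕ
  numQ : ℕ
  numR : ℕ
  M : Fin numM → Seg
  M' : Fin numM' → Seg
  Q : Fin numQ → Seg
  R : Fin numR → Seg
  /-- the pieces `M` and `Q` together make up `P` -/
  subdivide_P : lengthMeasure M + lengthMeasure Q = lengthMeasure P
  /-- the pieces `M'` and `R` together make up `S` -/
  subdivide_S : lengthMeasure M' + lengthMeasure R = lengthMeasure S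
  /-- the transport plan between the matched parts -/
  τM : Measure (Plane × Plane)
  τM_plan : IsTransportPlan (lengthMeasure M) (lengthMeasure M') τM
  τM_close : ∀ᵐ z ∂τM, dist z.1 z.2 ≤ δ / ((n : ℝ) * m)
  ratio : ∀ q r, ∀ x ∈ (Q q).carrier, ∀ y ∈ (R r).carrier,
    ∀ x' ∈ (Q q).carrier, ∀ y' ∈ (R r).carrier, dist x y ≤ (1 + δ) * dist x' y'
  u : Fin numQ → Plane
  v : Fin numR → Plane
  u_mem : ∀ q, u q ∈ (Q q).carrier
  v_mem : ∀ r, v r ∈ (R r).carrier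
  ν : Fin numQ → Fin numR → ℝ
  ν_plan : IsDiscretePlan (fun q => (Q q).len) (fun r => (R r).len) ν
  ν_optimal : ∀ w, IsDiscretePlan (fun q => (Q q).len) (fun r => (R r).len) w →
    discreteCost u v ν ≤ discreteCost u v w

/-- The transport plan that a run of the construction returns: the plan between the matched parts
plus the plan `ν`, spread evenly over the pieces of the remainder. -/
def MatchSubdivide.plan {δ : ℝ} {n m : ℕ} {P : Fin n → Seg} {S : Fin m → Seg}
    (X : MatchSubdivide δ P S) : Measure (Plane × Plane) :=
  X.τM + spread X.Q X.R X.ν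

/-! ### A randomised real RAM with unit costs -/

/-- Contents of the machine: registers and (unbounded) arrays that hold natural numbers,
registers and arrays that hold real numbers, and the number of random numbers drawn so far. -/
structure RAMState where
  nreg : ℕ → ℕ
  rreg : ℕ → ℝ
  narr : ℕ → ℕ → ℕ
  rarr : ℕ → ℕ → ℝ
  drawn : ℕ

/-- Elementary instructions; `d` is the destination register, and arrays are addressed through a
natural number register `i`.  There is no rounding from reals to integers. -/
inductive Instr
  | nconst (d c : ℕ)
  | nadd (d x y : ℕ)
  | nsub (d x y : ℕ)
  | nload (d arr i : ℕ)
  | nstore (arr i x : ℕ)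
  | rcast (d x : ℕ)
  | radd (d x y : ℕ)
  | rsub (d x y : ℕ)
  | rmul (d x y : ℕ)
  | rdiv (d x y : ℕ)
  | rsqrt (d x : ℕ)
  | rload (d arr i : ℕ)
  | rstore (arr i x : ℕ)
  | rand (d : ℕ)

namespace RAMState

def setN (s : RAMState) (d v : ℕ) : RAMState :=
  { s with nreg := Function.update s.nreg d v }

def setR (s : RAMState) (d : ℕ) (v : ℝ) : RAMState :=
  { s with rreg := Function.update s.rreg d v }

def setNArr (s : RAMState) (arr i v : ℕ) : RAMState :=
  { s with narr := Function.update s.narr arr (Function.update (s.narr arr) i v) }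

def setRArr (s : RAMState) (arr i : ℕ) (v : ℝ) : RAMState :=
  { s with rarr := Function.update s.rarr arr (Function.update (s.rarr arr) i v) }

end RAMState

/-- An infinite supply of random numbers from `[0, 1]`. -/
abbrev RandomTape := ℕ → unitInterval

/-- The random numbers are independent and uniform in `[0, 1]`. -/
def tapeMeasure : Measure RandomTape :=
  Measure.infinitePi (fun _ : ℕ => (volume : Measure unitInterval))

/-- Effect of an elementary instruction. -/
def Instr.apply (ω : RandomTape) (s : RAMState) : Instr → RAMState
  | .nconst d c => s.setN d c
  | .nadd d x y => s.setN d (s.nreg x + s.nreg y)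
  | .nsub d x y => s.setN d (s.nreg x - s.nreg y)
  | .nload d arr i => s.setN d (s.narr arr (s.nreg i))
  | .nstore arr i x => s.setNArr arr (s.nreg i) (s.nreg x)
  | .rcast d x => s.setR d (s.nreg x : ℝ)
  | .radd d x y => s.setR d (s.rreg x + s.rreg y)
  | .rsub d x y => s.setR d (s.rreg x - s.rreg y)
  | .rmul d x y => s.setR d (s.rreg x * s.rreg y)
  | .rdiv d x y => s.setR d (s.rreg x / s.rreg y)
  | .rsqrt d x => s.setR d (Real.sqrt (s.rreg x))
  | .rload d arr i => s.setR d (s.rarr arr (s.nreg i))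
  | .rstore arr i x => s.setRArr arr (s.nreg i) (s.rreg x)
  | .rand d => { s.setR d (ω s.drawn : ℝ) with drawn := s.drawn + 1 }

/-- Tests: comparison of two registers. -/
inductive Test
  | nlt (x y : ℕ)
  | rlt (x y : ℕ)

def Test.holds (s : RAMState) : Test → Prop
  | .nlt x y => s.nreg x < s.nreg y
  | .rlt x y => s.rreg x < s.rreg y

/-- Programs. -/
inductive Prog
  | basic (i : Instr)
  | seq (p q : Prog)
  | ite (c : Test) (p q : Prog)
  | loop (c : Test) (p : Prog)

/-- `Exec ω p s s' t`: on the random numbers `ω`, the program `p`, started in the state `s`, halts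
in the state `s'` after `t` steps; every instruction and every test is one step.
`loop c p` repeats `p` while `c` holds. -/
inductive Exec (ω : RandomTape) : Prog → RAMState → RAMState → ℕ → Prop
  | basic (i : Instr) (s : RAMState) : Exec ω (.basic i) s (i.apply ω s) 1
  | seq {p q : Prog} {s s₁ s₂ : RAMState} {t₁ t₂ : ℕ} :
      Exec ω p s s₁ t₁ → Exec ω q s₁ s₂ t₂ → Exec ω (.seq p q) s s₂ (t₁ + t₂)
  | ite_pos {c : Test} {p q : Prog} {s s' : RAMState} {t : ℕ} :
      c.holds s → Exec ω p s s' t → Exec ω (.ite c p q) s s' (t + 1)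
  | ite_neg {c : Test} {p q : Prog} {s s' : RAMState} {t : ℕ} :
      ¬ c.holds s → Exec ω q s s' t → Exec ω (.ite c p q) s s' (t + 1)
  | loop_stop {c : Test} {p : Prog} {s : RAMState} :
      ¬ c.holds s → Exec ω (.loop c p) s s 1
  | loop_step {c : Test} {p : Prog} {s s₁ s₂ : RAMState} {t₁ t₂ : ℕ} :
      c.holds s → Exec ω p s s₁ t₁ → Exec ω (.loop c p) s₁ s₂ t₂ →
        Exec ω (.loop c p) s s₂ (t₁ + t₂ + 1)

/-- Array contents: a finite list of reals followed by zeros. -/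
def padArr {k : ℕ} (x : Fin k → ℝ) (i : ℕ) : ℝ := if h : i < k then x ⟨i, h⟩ else 0

/-- A start state: the sizes `n`, `m` and the accuracy `δ` in registers, real arrays as given,
everything else zero. -/
def startState (n m : ℕ) (δ : ℝ) (arrs : ℕ → ℕ → ℝ) : RAMState where
  nreg := fun r => if r = 0 then n else if r = 1 then m else 0
  rreg := fun r => if r = 0 then δ else 0
  narr := fun _ _ => 0
  rarr := arrs
  drawn := 0

/-! ### What it means for a program to solve a transport problem -/

/-- Input of a program for weighted points: arrays `0, 1, 2` hold the coordinates and weights of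
the first set, arrays `3, 4, 5` those of the second set. -/
def pointInput (δ : ℝ) {k l : ℕ} (x : Fin k → Plane) (a : Fin k → ℝ)
    (y : Fin l → Plane) (b : Fin l → ℝ) : RAMState :=
  startState k l δ fun A =>
    match A with
    | 0 => padArr fun i => x i 0
    | 1 => padArr fun i => x i 1
    | 2 => padArr a
    | 3 => padArr fun j => y j 0
    | 4 => padArr fun j => y j 1
    | 5 => padArr b
    | _ => fun _ => 0

/-- The plan that a final state `s` describes: register `0` holds the number of entries, and entry
`e` moves mass `rarr 6 e` from point number `narr 0 e` to point number `narr 1 e`. -/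
def pointOutput (s : RAMState) (k l : ℕ) : Fin k → Fin l → ℝ := fun i j =>
  ∑ e ∈ Finset.range (s.nreg 0),
    if s.narr 0 e = i ∧ s.narr 1 e = j then s.rarr 6 e else 0

/-- On the random numbers `ω`, program `A` constructs within time `T` a transport plan between the
weighted points `(x, a)` and `(y, b)` whose cost is at most `1 + δ` times the optimum.
The time is the number of steps plus one unit for each entry of the plan that is output. -/
def SolvesPoints (A : Prog) (ω : RandomTape) (δ T : ℝ) {k l : ℕ} (x : Fin k → Plane)
    (a : Fin k → ℝ) (y : Fin l → Plane) (b : Fin l → ℝ) : Prop :=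
  ∃ (s : RAMState) (t : ℕ), Exec ω A (pointInput δ x a y b) s t ∧
    ((t + s.nreg 0 : ℕ) : ℝ) ≤ T ∧
    (∀ e < s.nreg 0, s.narr 0 e < k ∧ s.narr 1 e < l ∧ 0 ≤ s.rarr 6 e) ∧
    IsDiscretePlan a b (pointOutput s k l) ∧
    ∀ w, IsDiscretePlan a b w →
      discreteCost x y (pointOutput s k l) ≤ (1 + δ) * discreteCost x y w

/-- `A` is a randomised algorithm that, for weighted point sets of `k` points in total, constructs
a `(1 + δ)`-approximate transport plan in time `f k`, except with probability at most `ρ k`. -/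
def IsPointAlgorithm (A : Prog) (δ : ℝ) (f : ℕ → ℝ) (ρ : ℕ → ℝ≥0∞) : Prop :=
  ∀ (k l : ℕ) (x : Fin k → Plane) (a : Fin k → ℝ) (y : Fin l → Plane) (b : Fin l → ℝ),
    0 < k → 0 < l → (∀ i, 0 < a i) → (∀ j, 0 < b j) → ∑ i, a i = ∑ j, b j →
      tapeMeasure {ω | ¬ SolvesPoints A ω δ (f (k + l)) x a y b} ≤ ρ (k + l)

/-- Input of a program for segments: arrays `0, 1, 2, 3` hold the coordinates of the end points of
the first family, arrays `4, 5, 6, 7` those of the second family. -/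
def segmentInput (δ : ℝ) {n m : ℕ} (P : Fin n → Seg) (S : Fin m → Seg) : RAMState :=
  startState n m δ fun A =>
    match A with
    | 0 => padArr fun i => (P i).a 0
    | 1 => padArr fun i => (P i).a 1
    | 2 => padArr fun i => (P i).b 0
    | 3 => padArr fun i => (P i).b 1
    | 4 => padArr fun j => (S j).a 0
    | 5 => padArr fun j => (S j).a 1
    | 6 => padArr fun j => (S j).b 0
    | 7 => padArr fun j => (S j).b 1
    | _ => fun _ => 0

/-- The segment whose end points have their coordinates at position `e` of the arrays
`c, …, c + 3`. -/
def segmentAt (s : RAMState) (c e : ℕ) : Seg where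
  a := !₂[s.rarr c e, s.rarr (c + 1) e]
  b := !₂[s.rarr (c + 2) e, s.rarr (c + 3) e]

/-- The plan that a final state `s` describes: register `0` holds the number of entries, and entry
`e` moves mass `rarr 16 e` from the segment stored in the arrays `8, …, 11` to the segment stored
in the arrays `12, …, 15`, spread evenly over both. -/
def segmentOutput (s : RAMState) : Measure (Plane × Plane) :=
  ∑ e ∈ Finset.range (s.nreg 0),
    ENNReal.ofReal (s.rarr 16 e) • (segmentAt s 8 e).unif.prod (segmentAt s 12 e).unif

/-- On the random numbers `ω`, program `B` constructs within time `T` a transport plan between the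
segment families `P` and `S` of cost at most `bound`.
The time is the number of steps plus one unit for each entry of the plan that is output. -/
def SolvesSegments (B : Prog) (ω : RandomTape) (δ T : ℝ) (bound : ℝ≥0∞) {n m : ℕ}
    (P : Fin n → Seg) (S : Fin m → Seg) : Prop :=
  ∃ (s : RAMState) (t : ℕ), Exec ω B (segmentInput δ P S) s t ∧
    ((t + s.nreg 0 : ℕ) : ℝ) ≤ T ∧
    (∀ e < s.nreg 0, 0 ≤ s.rarr 16 e) ∧
    IsTransportPlan (lengthMeasure P) (lengthMeasure S) (segmentOutput s) ∧
    planCost (segmentOutput s) ≤ bound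

/-- `P` is a family of non-degenerate segments of total length one. -/
def IsUnitFamily {n : ℕ} (P : Fin n → Seg) : Prop :=
  (∀ i, 0 < (P i).len) ∧ ∑ i, (P i).len = 1

end

/-! Cost of the construction. The ratio condition makes every distance between pieces `q` and `r`
comparable, up to a factor `1 + δ`, to the distance of the chosen points. Spreading `ν` therefore
costs at most `1 + δ` times its discrete cost, and it remains to find some plan between the pieces
whose cost, measured by lower bounds for the distances, is at most the EMD plus the cost of `τM`. No
plan is glued or disintegrated for this; it is obtained by duality. Discrete potentials `φ`, `ψ`
with `φ q - ψ r` at most every distance between the pieces extend to the 1-Lipschitz function `f x =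
min_r (ψ r + dist(x, R r))`, which is at least `φ q` on `Q q` and at most `ψ r` on `R r`.
Integrating `f` against `Q - R = (P - S) - (M - M')` bounds the dual value by EMD plus the cost of
`τM` (`ofReal_dual_le_emd`), and finite-dimensional strong duality (`exists_dual`, by Hahn–Banach)
returns a plan (`exists_plan_le_emd`). Finally `(1 + δ)² ≤ 1 + 3δ`.

Existence of the construction. All segments are cut into pieces of length at most `g = δ² / (4nm)`.
Two short pieces that violate the ratio condition must be close to each other, so the shorter one
may be matched with a part of the other. This lowers the number of unmatched pieces, so the greedy
matching stops without creating more of them (`exists_greedy_matching`).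

Algorithm. The program does not match at all. It cuts everything into pieces of length at most `g =
δ / ((1 + δ)nm)`, represents each by its first end point and calls `A`. Distances change by at most
`2g` and the total mass is one, so the error is additive and of order `δ / (nm)`, while the lower
bound is again `exists_plan_le_emd`, now with nothing matched (`planCost_spread_le_of_refines`).
There are at most `8nm / min(δ, 1)²` points.

The program `segmentProgram A` keeps its own data in registers and arrays beyond `A.bound`, which
`A` can neither read nor write, and draws no random numbers itself. So `A` runs as on a genuine
point input with the same tape, and failures correspond (`Exec.agreeBelow`,
`exists_point_instance`). The overhead is linear in the number of pieces. It is absorbed by the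
running time of `A` because every point has positive weight and must occur in an entry of the
output, which is paid for (`card_le_of_isDiscretePlan_pointOutput`). -/

/-! ### The mass distribution of a segment -/

namespace Seg

/-- The mass distribution of a segment with density one with respect to arc length. -/
noncomputable def meas (s : Seg) : Measure Plane := ENNReal.ofReal s.len • s.unif

theorem len_nonneg (s : Seg) : 0 ≤ s.len := dist_nonneg

theorem continuous_param (s : Seg) : Continuous fun t : ℝ => AffineMap.lineMap s.a s.b t :=
  AffineMap.lineMap_continuous

instance (s : Seg) : IsProbabilityMeasure s.unif := by
  have : IsProbabilityMeasure (volume.restrict (Set.Icc (0 : ℝ) 1)) :=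
    ⟨by simp [Real.volume_Icc]⟩
  exact Measure.isProbabilityMeasure_map s.continuous_param.aemeasurable

theorem unif_apply (s : Seg) {A : Set Plane} (hA : MeasurableSet A) :
    s.unif A = volume ((fun t : ℝ => AffineMap.lineMap s.a s.b t) ⁻¹' A ∩ Set.Icc 0 1) := by
  rw [unif, Measure.map_apply s.continuous_param.measurable hA,
    Measure.restrict_apply (s.continuous_param.measurable hA)]

theorem ae_mem_carrier (s : Seg) : ∀ᵐ x ∂s.unif, x ∈ s.carrier := by
  have hc : IsClosed s.carrier := by
    rw [carrier, segment_eq_image_lineMap]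
    exact (isCompact_Icc.image s.continuous_param).isClosed
  refine (ae_map_iff s.continuous_param.aemeasurable hc.measurableSet).2 ?_
  filter_upwards [ae_restrict_mem measurableSet_Icc] with t ht
  change _ ∈ segment ℝ s.a s.b
  rw [segment_eq_image_lineMap]
  exact ⟨t, ht, rfl⟩

/-- A segment is the convex hull of its end points, and passing to the convex hull does not change
the diameter. -/
theorem dist_le_len (s : Seg) {x y : Plane} (hx : x ∈ s.carrier) (hy : y ∈ s.carrier) :
    dist x y ≤ s.len := by
  have h := Metric.dist_le_diam_of_mem (s := segment ℝ s.a s.b)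
    (by rw [segment_eq_image_lineMap]
        exact (isCompact_Icc.image s.continuous_param).isBounded) hx hy
  rwa [← convexHull_pair, convexHull_diam, Metric.diam_pair] at h

theorem left_mem (s : Seg) : s.a ∈ s.carrier := left_mem_segment _ _ _

/-- The part of a segment between the parameters `α` and `β`. -/
noncomputable def part (s : Seg) (α β : ℝ) : Seg where
  a := AffineMap.lineMap s.a s.b α
  b := AffineMap.lineMap s.a s.b β

theorem part_len (s : Seg) {α β : ℝ} (h : α ≤ β) : (s.part α β).len = (β - α) * s.len := by
  simp only [part, len]
  rw [dist_lineMap_lineMap, dist_comm, Real.dist_eq, abs_of_nonneg (by linarith)]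

theorem part_zero_one (s : Seg) : s.part 0 1 = s := by simp [part]

theorem part_carrier_subset (s : Seg) {α β : ℝ} (hα : 0 ≤ α) (hβ : β ≤ 1) (h : α ≤ β) :
    (s.part α β).carrier ⊆ s.carrier := by
  refine (convex_segment s.a s.b).segment_subset ?_ ?_ <;>
  · simp only [part]
    rw [segment_eq_image_lineMap]
    exact ⟨_, ⟨by linarith, by linarith⟩, rfl⟩

/-- The parametrisation of the part is that of `s` after `t ↦ α + (β - α) t`, and Lebesgue measure
is translation invariant and scales by `β - α`. With this, cutting segments becomes cutting
parameter intervals. -/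
theorem part_unif_apply (s : Seg) {α β : ℝ} (h : α ≤ β) {A : Set Plane} (hA : MeasurableSet A) :
    ENNReal.ofReal (β - α) * (s.part α β).unif A =
      volume ((fun t : ℝ => AffineMap.lineMap s.a s.b t) ⁻¹' A ∩ Set.Icc α β) := by
  rcases h.eq_or_lt with rfl | h
  · simp only [sub_self, ENNReal.ofReal_zero, zero_mul, Set.Icc_self]
    exact (measure_mono_null Set.inter_subset_right (by simp)).symm
  set B := (fun t : ℝ => (AffineMap.lineMap s.a s.b t : Plane)) ⁻¹' A
  have hc : 0 < β - α := by linarith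
  have e : (fun t : ℝ => (AffineMap.lineMap (s.part α β).a (s.part α β).b t : Plane)) ⁻¹' A
      ∩ Set.Icc 0 1 = (fun t : ℝ => (β - α) * t) ⁻¹' ((fun t => α + t) ⁻¹' (B ∩ Set.Icc α β)) := by
    ext t
    have h1 : (AffineMap.lineMap (s.part α β).a (s.part α β).b t : Plane) =
        AffineMap.lineMap s.a s.b (α + (β - α) * t) := by
      simp only [part, AffineMap.lineMap_apply_module']
      module
    simp only [Set.mem_inter_iff, Set.mem_preimage, h1, Set.mem_Icc, B]
    refine and_congr Iff.rfl (and_congr ⟨fun h => ?_, fun h => ?_⟩ ⟨fun h => ?_, fun h => ?_⟩)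
    · nlinarith
    · by_contra hn
      nlinarith
    · nlinarith
    · by_contra hn
      nlinarith
  rw [unif_apply _ hA, e, Real.volume_preimage_mul_left hc.ne', measure_preimage_add, ← mul_assoc,
    abs_of_pos (inv_pos.2 hc), ← ENNReal.ofReal_mul hc.le, mul_inv_cancel₀ hc.ne',
    ENNReal.ofReal_one, one_mul]

theorem part_meas_apply (s : Seg) {α β : ℝ} (h : α ≤ β) {A : Set Plane} (hA : MeasurableSet A) :
    (s.part α β).meas A = ENNReal.ofReal s.len *
      volume ((fun t : ℝ => AffineMap.lineMap s.a s.b t) ⁻¹' A ∩ Set.Icc α β) := by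
  rw [meas, Measure.smul_apply, smul_eq_mul, s.part_len h, mul_comm (β - α),
    ENNReal.ofReal_mul s.len_nonneg, mul_assoc, part_unif_apply s h hA]

/-- The parameter intervals `[0, t]` and `[t, 1]` overlap in a null set only. -/
theorem meas_split (s : Seg) {t : ℝ} (h0 : 0 ≤ t) (h1 : t ≤ 1) :
    (s.part 0 t).meas + (s.part t 1).meas = s.meas := by
  ext A hA
  conv_rhs => rw [← s.part_zero_one]
  rw [Measure.add_apply, part_meas_apply s h0 hA, part_meas_apply s h1 hA,
    part_meas_apply s zero_le_one hA, ← mul_add]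
  congr 1
  set B := (fun t : ℝ => (AffineMap.lineMap s.a s.b t : Plane)) ⁻¹' A
  have hB : MeasurableSet B := s.continuous_param.measurable hA
  have e : volume (B ∩ Set.Icc t 1) = volume (B ∩ Set.Ioc t 1) :=
    measure_congr ((ae_eq_refl B).inter Ioc_ae_eq_Icc.symm)
  rw [e, ← measure_union _ (hB.inter measurableSet_Ioc), ← Set.inter_union_distrib_left,
    Set.Icc_union_Ioc_eq_Icc h0 h1]
  refine Set.disjoint_left.2 fun x hx hy => ?_
  have := hx.2.2
  have := hy.2.1
  linarith

theorem meas_univ (s : Seg) : s.meas Set.univ = ENNReal.ofReal s.len := by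
  simp [meas]

end Seg

theorem lengthMeasure_eq_sum {n : ℕ} (P : Fin n → Seg) :
    lengthMeasure P = ∑ i, (P i).meas := rfl

theorem lengthMeasure_univ {n : ℕ} (P : Fin n → Seg) :
    lengthMeasure P Set.univ = ENNReal.ofReal (∑ i, (P i).len) := by
  rw [lengthMeasure_eq_sum, Measure.finsetSum_apply,
    ENNReal.ofReal_sum_of_nonneg fun i _ => (P i).len_nonneg]
  simp [Seg.meas_univ]

instance {n : ℕ} (P : Fin n → Seg) : IsFiniteMeasure (lengthMeasure P) :=
  ⟨by rw [lengthMeasure_univ]; exact ENNReal.ofReal_lt_top⟩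

/-! ### Transport plans -/

theorem IsTransportPlan.add {μ ν μ' ν' : Measure Plane} {π π' : Measure (Plane × Plane)}
    (h : IsTransportPlan μ ν π) (h' : IsTransportPlan μ' ν' π') :
    IsTransportPlan (μ + μ') (ν + ν') (π + π') := by
  constructor
  · rw [Measure.fst, Measure.map_add _ _ measurable_fst, ← h.1, ← h'.1]; rfl
  · rw [Measure.snd, Measure.map_add _ _ measurable_snd, ← h.2, ← h'.2]; rfl

theorem isTransportPlan_zero : IsTransportPlan 0 0 0 := by
  constructor <;> simp

theorem IsTransportPlan.sum {ι : Type*} (s : Finset ι) {μ ν : ι → Measure Plane}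
    {π : ι → Measure (Plane × Plane)} (h : ∀ i ∈ s, IsTransportPlan (μ i) (ν i) (π i)) :
    IsTransportPlan (∑ i ∈ s, μ i) (∑ i ∈ s, ν i) (∑ i ∈ s, π i) := by
  classical
  induction s using Finset.induction_on with
  | empty => simpa using isTransportPlan_zero
  | insert i s hi ih =>
    simp only [Finset.sum_insert hi]
    exact (h i (by simp)).add (ih fun j hj => h j (by simp [hj]))

theorem isTransportPlan_smul_prod (c : ℝ≥0∞) (q r : Seg) :
    IsTransportPlan (c • q.unif) (c • r.unif) (c • q.unif.prod r.unif) := by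
  constructor
  · rw [Measure.fst, Measure.map_smul]
    change c • (q.unif.prod r.unif).fst = _
    rw [Measure.fst_prod]
  · rw [Measure.snd, Measure.map_smul]
    change c • (q.unif.prod r.unif).snd = _
    rw [Measure.snd_prod]

theorem IsTransportPlan.univ_eq {μ ν : Measure Plane} {π : Measure (Plane × Plane)}
    (h : IsTransportPlan μ ν π) : μ Set.univ = π Set.univ ∧ ν Set.univ = π Set.univ := by
  rw [← h.1, ← h.2, Measure.fst_univ, Measure.snd_univ]
  exact ⟨rfl, rfl⟩

theorem isTransportPlan_spread {k l : ℕ} (Q : Fin k → Seg) (R : Fin l → Seg)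
    {w : Fin k → Fin l → ℝ} (h : IsDiscretePlan (fun q => (Q q).len) (fun r => (R r).len) w) :
    IsTransportPlan (lengthMeasure Q) (lengthMeasure R) (spread Q R w) := by
  have h1 := IsTransportPlan.sum Finset.univ fun q _ => IsTransportPlan.sum Finset.univ fun r _ =>
    isTransportPlan_smul_prod (ENNReal.ofReal (w q r)) (Q q) (R r)
  convert h1 using 1
  · refine Finset.sum_congr rfl fun q _ => ?_
    rw [← Finset.sum_smul, ← ENNReal.ofReal_sum_of_nonneg fun r _ => h.nonneg q r, h.row]
  · rw [Finset.sum_comm]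
    refine Finset.sum_congr rfl fun r _ => ?_
    rw [← Finset.sum_smul, ← ENNReal.ofReal_sum_of_nonneg fun q _ => h.nonneg q r, h.col]
  · rfl

theorem planCost_add (π π' : Measure (Plane × Plane)) :
    planCost (π + π') = planCost π + planCost π' := lintegral_add_measure _ _ _

theorem planCost_le_of_ae {π : Measure (Plane × Plane)} {c : ℝ}
    (h : ∀ᵐ z ∂π, dist z.1 z.2 ≤ c) : planCost π ≤ ENNReal.ofReal c * π Set.univ := by
  refine (lintegral_mono_ae (g := fun _ => ENNReal.ofReal c) ?_).trans (by simp)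
  filter_upwards [h] with z hz
  rw [edist_dist]
  exact ENNReal.ofReal_le_ofReal hz

theorem ae_prod_mem (q r : Seg) :
    ∀ᵐ z ∂(q.unif.prod r.unif), z.1 ∈ q.carrier ∧ z.2 ∈ r.carrier :=
  (Measure.quasiMeasurePreserving_fst.ae q.ae_mem_carrier).and
    (Measure.quasiMeasurePreserving_snd.ae r.ae_mem_carrier)

/-- Upper half of the comparison with the discrete problem: the mass `w q r` travels between points
of the two pieces only. -/
theorem planCost_spread_le {k l : ℕ} (Q : Fin k → Seg) (R : Fin l → Seg)
    {w : Fin k → Fin l → ℝ} (hw : ∀ q r, 0 ≤ w q r) {c : Fin k → Fin l → ℝ}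
    (hc0 : ∀ q r, 0 ≤ c q r)
    (hc : ∀ q r, ∀ x ∈ (Q q).carrier, ∀ y ∈ (R r).carrier, dist x y ≤ c q r) :
    planCost (spread Q R w) ≤ ENNReal.ofReal (∑ q, ∑ r, w q r * c q r) := by
  rw [ENNReal.ofReal_sum_of_nonneg fun q _ => Finset.sum_nonneg fun r _ =>
    mul_nonneg (hw q r) (hc0 q r), planCost, spread, lintegral_finsetSum_measure]
  refine Finset.sum_le_sum fun q _ => ?_
  rw [ENNReal.ofReal_sum_of_nonneg fun r _ => mul_nonneg (hw q r) (hc0 q r),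
    lintegral_finsetSum_measure]
  refine Finset.sum_le_sum fun r _ => ?_
  rw [lintegral_smul_measure, ENNReal.ofReal_mul (hw q r), smul_eq_mul]
  refine mul_le_mul_right ?_ _
  refine (planCost_le_of_ae (c := c q r) ?_).trans (by simp)
  filter_upwards [ae_prod_mem (Q q) (R r)] with z hz using hc q r _ hz.1 _ hz.2

/-! ### Duality for transport between weighted points -/

theorem exists_isDiscretePlan {k l : ℕ} {a : Fin k → ℝ} {b : Fin l → ℝ} (ha : ∀ i, 0 ≤ a i)
    (hb : ∀ j, 0 ≤ b j) (hab : ∑ i, a i = ∑ j, b j) : ∃ w, IsDiscretePlan a b w := by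
  refine ⟨fun i j => a i * b j / ∑ i, a i, fun i j => ?_, fun i => ?_, fun j => ?_⟩
  · exact div_nonneg (mul_nonneg (ha i) (hb j)) (Finset.sum_nonneg fun i _ => ha i)
  · rw [← Finset.sum_div, ← Finset.mul_sum, ← hab]
    -- For total mass zero the quotient is zero by convention, which is right because all weights
    -- vanish.
    by_cases h : ∑ i, a i = 0
    · rw [(Finset.sum_eq_zero_iff_of_nonneg fun i _ => ha i).1 h i (Finset.mem_univ i)]
      simp
    · exact mul_div_cancel_right₀ _ h
  · rw [← Finset.sum_div, ← Finset.sum_mul]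
    by_cases h : ∑ i, a i = 0
    · rw [hab] at h
      rw [(Finset.sum_eq_zero_iff_of_nonneg fun j _ => hb j).1 h j (Finset.mem_univ j)]
      simp
    · exact mul_div_cancel_left₀ _ h

theorem IsDiscretePlan.le_row {k l : ℕ} {a : Fin k → ℝ} {b : Fin l → ℝ}
    {w : Fin k → Fin l → ℝ} (h : IsDiscretePlan a b w) (i : Fin k) (j : Fin l) : w i j ≤ a i :=
  (Finset.single_le_sum (fun j _ => h.nonneg i j) (Finset.mem_univ j)).trans (h.row i).le

theorem isCompact_setOf_isDiscretePlan {k l : ℕ} (a : Fin k → ℝ) (b : Fin l → ℝ) :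
    IsCompact {w | IsDiscretePlan a b w} := by
  refine (isCompact_univ_pi fun i : Fin k => isCompact_univ_pi fun _ : Fin l =>
    isCompact_Icc (a := (0 : ℝ)) (b := a i)).of_isClosed_subset ?_ ?_
  · have e : {w | IsDiscretePlan a b w} = ((⋂ i, ⋂ j, {w : Fin k → Fin l → ℝ | 0 ≤ w i j}) ∩
        (⋂ i, {w | ∑ j, w i j = a i})) ∩ ⋂ j, {w | ∑ i, w i j = b j} := by
      ext w
      simp only [Set.mem_inter_iff, Set.mem_iInter, Set.mem_ofPred_eq]
      exact ⟨fun h => ⟨⟨h.nonneg, h.row⟩, h.col⟩, fun h => ⟨h.1.1, h.1.2, h.2⟩⟩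
    rw [e]
    refine ((isClosed_iInter fun i => isClosed_iInter fun j => ?_).inter
      (isClosed_iInter fun i => ?_)).inter (isClosed_iInter fun j => ?_)
    · exact isClosed_le (by fun_prop) (by fun_prop)
    · exact isClosed_eq (by fun_prop) (by fun_prop)
    · exact isClosed_eq (by fun_prop) (by fun_prop)
  · intro w hw
    simp only [Set.mem_pi, Set.mem_univ, true_imp_iff]
    exact fun i j => ⟨hw.nonneg i j, hw.le_row i j⟩

theorem exists_optimal_plan {k l : ℕ} {a : Fin k → ℝ} {b : Fin l → ℝ} (ha : ∀ i, 0 ≤ a i)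
    (hb : ∀ j, 0 ≤ b j) (hab : ∑ i, a i = ∑ j, b j) (c : Fin k → Fin l → ℝ) :
    ∃ w, IsDiscretePlan a b w ∧ ∀ w', IsDiscretePlan a b w' →
      ∑ i, ∑ j, w i j * c i j ≤ ∑ i, ∑ j, w' i j * c i j := by
  obtain ⟨w, hw, h⟩ := (isCompact_setOf_isDiscretePlan a b).exists_isMinOn
    (exists_isDiscretePlan ha hb hab)
    (f := fun w : Fin k → Fin l → ℝ => ∑ i, ∑ j, w i j * c i j)
    (Continuous.continuousOn (by fun_prop))
  exact ⟨w, hw, fun w' hw' => h hw'⟩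

/-! ### Strong duality by separation -/

/-- Row sums, column sums and cost of a matrix of masses. -/
def massMap {k l : ℕ} (c : Fin k → Fin l → ℝ) :
    (Fin k → Fin l → ℝ) →ₗ[ℝ] (Fin k → ℝ) × (Fin l → ℝ) × ℝ where
  toFun w := (fun i => ∑ j, w i j, fun j => ∑ i, w i j, ∑ i, ∑ j, w i j * c i j)
  map_add' w w' := by
    ext <;> simp [Finset.sum_add_distrib, add_mul]
  map_smul' t w := by
    ext <;> simp [Finset.mul_sum, mul_assoc]

/-- The triple `(a, b, v)` with `v` below the optimum is not the triple of row sums, column sums and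
cost of any nonnegative matrix. A hyperplane that separates it from these triples has the potentials
as coefficients. Separating only from the image of a compact box makes closedness automatic; the
price is an error `η` in the dual constraints, paid for by the gap between `v₀` and the optimum. -/
theorem exists_dual {k l : ℕ} {a : Fin k → ℝ} {b : Fin l → ℝ} (ha : ∀ i, 0 ≤ a i)
    {c : Fin k → Fin l → ℝ} {w : Fin k → Fin l → ℝ} (hw : IsDiscretePlan a b w)
    (hopt : ∀ w', IsDiscretePlan a b w' → ∑ i, ∑ j, w i j * c i j ≤ ∑ i, ∑ j, w' i j * c i j)
    {v₀ : ℝ} (hv : v₀ < ∑ i, ∑ j, w i j * c i j) :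
    ∃ (φ : Fin k → ℝ) (ψ : Fin l → ℝ), (∀ i j, φ i - ψ j ≤ c i j) ∧
      v₀ < ∑ i, a i * φ i - ∑ j, b j * ψ j := by
  set opt := ∑ i, ∑ j, w i j * c i j with hoptdef
  -- With the midpoint, `v - v₀ = opt - v`: one half of the gap separates, the other absorbs the
  -- error `η`.
  set v := (v₀ + opt) / 2 with hvdef
  set A := ∑ i, a i with hAdef
  have hA : 0 ≤ A := Finset.sum_nonneg fun i _ => ha i
  have hwA : ∀ i j, w i j ≤ A := fun i j =>
    (hw.le_row i j).trans (Finset.single_le_sum (fun i _ => ha i) (Finset.mem_univ i))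
  -- Entries of `w` are at most `A`, so there is room to increase any one of them by `A + 1`.
  let box : Set (Fin k → Fin l → ℝ) :=
    Set.univ.pi fun _ => Set.univ.pi fun _ => Set.Icc 0 (2 * A + 1)
  have hbox : ∀ w' : Fin k → Fin l → ℝ, (∀ i j, 0 ≤ w' i j ∧ w' i j ≤ 2 * A + 1) → w' ∈ box := by
    intro w' h
    simp only [box, Set.mem_pi, Set.mem_univ, true_imp_iff]
    exact h
  have hconv : Convex ℝ (massMap c '' box) :=
    (convex_pi fun _ _ => convex_pi fun _ _ => convex_Icc _ _).linear_image _
  have hcl : IsClosed (massMap c '' box) :=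
    ((isCompact_univ_pi fun _ => isCompact_univ_pi fun _ => isCompact_Icc).image
      (LinearMap.continuous_of_finiteDimensional _)).isClosed
  have hnot : ((a, b, v) : (Fin k → ℝ) × (Fin l → ℝ) × ℝ) ∉ massMap c '' box := by
    rintro ⟨w', hw', h⟩
    simp only [massMap, LinearMap.coe_mk, AddHom.coe_mk, Prod.mk.injEq] at h
    simp only [box, Set.mem_pi, Set.mem_univ, true_imp_iff] at hw'
    have := hopt w' ⟨fun i j => (hw' i j).1, fun i => congrFun h.1 i, fun j => congrFun h.2.1 j⟩
    rw [h.2.2] at this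
    linarith
  obtain ⟨F, u, hFp, hF⟩ := geometric_hahn_banach_point_closed hconv hcl hnot
  have key : ∀ w' ∈ box, F (a, b, v) < F (massMap c w') := fun w' h =>
    hFp.trans (hF _ ⟨w', h, rfl⟩)
  let E : Fin k → Fin l → Fin k → Fin l → ℝ := fun i j => Pi.single i (Pi.single j 1)
  let lam : ℝ := F (0, 0, 1)
  let Φ : Fin k → ℝ := fun i => F (Pi.single i 1, 0, 0)
  let Ψ : Fin l → ℝ := fun j => F (0, Pi.single j 1, 0)
  have hFform : ∀ x y z, F (x, y, z) = ∑ i, x i * Φ i + ∑ j, y j * Ψ j + z * lam := by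
    intro x y z
    have e : ((x, y, z) : (Fin k → ℝ) × (Fin l → ℝ) × ℝ) =
        ∑ i, x i • ((Pi.single i 1, 0, 0) : (Fin k → ℝ) × (Fin l → ℝ) × ℝ) +
        ∑ j, y j • ((0, Pi.single j 1, 0) : (Fin k → ℝ) × (Fin l → ℝ) × ℝ) +
        z • ((0, 0, 1) : (Fin k → ℝ) × (Fin l → ℝ) × ℝ) := by
      ext <;> simp [Prod.fst_sum, Prod.snd_sum, Finset.sum_apply, Pi.single_apply]
    rw [e]
    simp only [map_add, map_sum, map_smul, smul_eq_mul]
    rfl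
  have hmw : massMap c w = (a, b, opt) := by
    simp only [massMap, LinearMap.coe_mk, AddHom.coe_mk, Prod.mk.injEq]
    exact ⟨funext hw.row, funext hw.col, rfl⟩
  -- Testing with the optimal plan `w`, which has the marginals `a`, `b` but cost `opt > v`.
  have hlam : 0 < lam := by
    have h := key w (hbox _ fun i j => ⟨hw.nonneg i j, by linarith [hwA i j]⟩)
    rw [hmw, hFform, hFform] at h
    have : 0 < (opt - v) * lam := by linarith
    exact pos_of_mul_pos_right this (by linarith)
  have hE : ∀ i j, massMap c (E i j) = (Pi.single i 1, Pi.single j 1, c i j) := by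
    intro i j
    ext x <;> simp [massMap, E, Pi.single_apply, apply_ite, ite_apply]
  set η := (opt - v) / (A + 1) with hη
  have hη0 : 0 ≤ η := div_nonneg (by linarith) (by linarith)
  have hηA : η * (A + 1) = opt - v := div_mul_cancel₀ _ (by linarith)
  refine ⟨fun i => -(Φ i / lam) - η, fun j => Ψ j / lam, fun i j => ?_, ?_⟩
  -- Increasing the entry `i, j` of `w` gives the dual constraint up to `(opt - v) / (A + 1) = η`,
  -- hence exactly after lowering all `φ i` by `η`.
  · have h := key (w + (A + 1) • E i j) (hbox _ fun i' j' => ?_)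
    · rw [map_add, map_smul, hE, hmw, Prod.smul_mk, Prod.smul_mk, Prod.mk_add_mk, Prod.mk_add_mk,
        hFform, hFform] at h
      simp only [Pi.add_apply, Pi.smul_apply, smul_eq_mul, add_mul, Finset.sum_add_distrib,
        Pi.single_apply, mul_ite, ite_mul, mul_one, mul_zero, zero_mul, Finset.sum_ite_eq',
        Finset.mem_univ, if_true, one_mul] at h
      have h2 : 0 < (η + Φ i / lam + Ψ j / lam + c i j) * ((A + 1) * lam) := by
        have : (η + Φ i / lam + Ψ j / lam + c i j) * ((A + 1) * lam) =
          (η * (A + 1)) * lam + (A + 1) * (Φ i + Ψ j + c i j * lam) := by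
          field_simp
          ring
        rw [this, hηA]
        linarith
      have := pos_of_mul_pos_left h2 (by positivity)
      linarith
    · simp only [Pi.add_apply, Pi.smul_apply, smul_eq_mul, E]
      have h1 := hw.nonneg i' j'
      have h2 := hwA i' j'
      have h3 : (0 : ℝ) ≤ (Pi.single i (Pi.single j (1 : ℝ)) : Fin k → Fin l → ℝ) i' j' ∧
          (Pi.single i (Pi.single j (1 : ℝ)) : Fin k → Fin l → ℝ) i' j' ≤ 1 := by
        by_cases hi : i' = i
        · subst hi
          by_cases hj : j' = j
          · subst hj; simp
          · simp [hj]
        · simp [hi]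
      constructor <;> nlinarith [h3.1, h3.2]
  -- Testing with the zero matrix bounds the dual value below by `v` before `φ` is lowered; lowering
  -- costs `A * η ≤ opt - v = v - v₀`.
  · have h := key 0 (hbox _ fun _ _ => ⟨le_rfl, by simp; linarith⟩)
    rw [map_zero, map_zero, hFform] at h
    have h2 : v < -(∑ i, a i * (Φ i / lam)) - ∑ j, b j * (Ψ j / lam) := by
      have e1 : ∑ i, a i * (Φ i / lam) = (∑ i, a i * Φ i) / lam := by
        rw [Finset.sum_div]; simp [mul_div_assoc]
      have e2 : ∑ i, b i * (Ψ i / lam) = (∑ i, b i * Ψ i) / lam := by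
        rw [Finset.sum_div]; simp [mul_div_assoc]
      rw [e1, e2, ← neg_div, ← sub_div, lt_div_iff₀ hlam]
      linarith
    have h3 : ∑ i, a i * (-(Φ i / lam) - η) = -(∑ i, a i * (Φ i / lam)) - A * η := by
      simp [mul_sub, Finset.sum_sub_distrib, hAdef, Finset.sum_mul]
    rw [h3]
    nlinarith

theorem exists_plan_of_forall_dual {k l : ℕ} {a : Fin k → ℝ} {b : Fin l → ℝ} (ha : ∀ i, 0 ≤ a i)
    (hb : ∀ j, 0 ≤ b j) (hab : ∑ i, a i = ∑ j, b j) (c : Fin k → Fin l → ℝ) {v : ℝ}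
    (h : ∀ (φ : Fin k → ℝ) (ψ : Fin l → ℝ), (∀ i j, φ i - ψ j ≤ c i j) →
      ∑ i, a i * φ i - ∑ j, b j * ψ j ≤ v) :
    ∃ w, IsDiscretePlan a b w ∧ ∑ i, ∑ j, w i j * c i j ≤ v := by
  obtain ⟨w, hw, hopt⟩ := exists_optimal_plan ha hb hab c
  refine ⟨w, hw, not_lt.1 fun hv => ?_⟩
  obtain ⟨φ, ψ, h1, h2⟩ := exists_dual ha hw hopt hv
  exact (h φ ψ h1).not_gt h2

/-! ### The earth mover's distance bounds the discrete optimum -/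

theorem Seg.integrable_unif (s : Seg) {f : Plane → ℝ} (hf : Continuous f) :
    Integrable f s.unif := by
  rw [Seg.unif, integrable_map_measure hf.aestronglyMeasurable s.continuous_param.aemeasurable]
  exact ((hf.comp s.continuous_param).continuousOn).integrableOn_Icc

theorem integrable_lengthMeasure {n : ℕ} (P : Fin n → Seg) {f : Plane → ℝ} (hf : Continuous f) :
    Integrable f (lengthMeasure P) :=
  integrable_finsetSum_measure.2 fun i _ => ((P i).integrable_unif hf).smul_measure (by simp)

theorem integral_lengthMeasure {n : ℕ} (P : Fin n → Seg) {f : Plane → ℝ} (hf : Continuous f) :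
    ∫ x, f x ∂lengthMeasure P = ∑ i, (P i).len * ∫ x, f x ∂(P i).unif := by
  rw [lengthMeasure, integral_finsetSum_measure
    fun i _ => ((P i).integrable_unif hf).smul_measure (by simp)]
  refine Finset.sum_congr rfl fun i _ => ?_
  rw [integral_smul_measure, ENNReal.toReal_ofReal (P i).len_nonneg, smul_eq_mul]

/-- The easy half of Kantorovich–Rubinstein duality: both integrals are integrals over the plan, and
`|f x - f y| ≤ dist x y`. -/
theorem enorm_integral_sub_le_planCost {μ ν : Measure Plane} {f : Plane → ℝ}
    (hf : LipschitzWith 1 f) (hμ : Integrable f μ) (hν : Integrable f ν)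
    {π : Measure (Plane × Plane)} (hπ : IsTransportPlan μ ν π) :
    ‖∫ x, f x ∂μ - ∫ x, f x ∂ν‖ₑ ≤ planCost π := by
  have hm := hf.continuous.aestronglyMeasurable (μ := μ)
  have hm' := hf.continuous.aestronglyMeasurable (μ := ν)
  rw [← hπ.1] at hμ hm ⊢
  rw [← hπ.2] at hν hm' ⊢
  have h1 : Integrable (fun z : Plane × Plane => f z.1) π :=
    (integrable_map_measure hm measurable_fst.aemeasurable).1 hμ
  have h2 : Integrable (fun z : Plane × Plane => f z.2) π :=
    (integrable_map_measure hm' measurable_snd.aemeasurable).1 hν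
  have e1 : ∫ x, f x ∂π.fst = ∫ z, f z.1 ∂π := integral_map measurable_fst.aemeasurable hm
  have e2 : ∫ x, f x ∂π.snd = ∫ z, f z.2 ∂π := integral_map measurable_snd.aemeasurable hm'
  rw [e1, e2, ← integral_sub h1 h2]
  refine (enorm_integral_le_lintegral_enorm _).trans (lintegral_mono fun z => ?_)
  rw [← edist_eq_enorm_sub]
  simpa using hf z.1 z.2

/-- Discrete potentials extend to a single 1-Lipschitz function on the plane, which is then tested
against all plans from `P` to `S` and against `τ`. The matched parts enter only through the
difference of the integrals over `M` and `M'`. -/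
theorem ofReal_dual_le_emd {n m kM kM' k l : ℕ} {P : Fin n → Seg} {S : Fin m → Seg}
    {M : Fin kM → Seg} {M' : Fin kM' → Seg} {Q : Fin k → Seg} {R : Fin l → Seg}
    (hP : lengthMeasure M + lengthMeasure Q = lengthMeasure P)
    (hS : lengthMeasure M' + lengthMeasure R = lengthMeasure S)
    {τ : Measure (Plane × Plane)} (hτ : IsTransportPlan (lengthMeasure M) (lengthMeasure M') τ)
    (hQR : ∑ q, (Q q).len = ∑ r, (R r).len) {φ : Fin k → ℝ} {ψ : Fin l → ℝ}
    (h : ∀ q r, ∀ x ∈ (Q q).carrier, ∀ y ∈ (R r).carrier, φ q - ψ r ≤ dist x y) :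
    ENNReal.ofReal (∑ q, (Q q).len * φ q - ∑ r, (R r).len * ψ r) ≤
      emd (lengthMeasure P) (lengthMeasure S) + planCost τ := by
  rcases isEmpty_or_nonempty (Fin l) with hl | hl
  -- Without pieces `R r` the minimum that defines `f` is over the empty set, but then no mass is
  -- left over.
  · have h0 : ∀ q, (Q q).len = 0 := fun q =>
      (Finset.sum_eq_zero_iff_of_nonneg fun q _ => (Q q).len_nonneg).1 (by simpa using hQR) q
        (Finset.mem_univ q)
    simp [h0]
  -- The largest function that is at most `ψ r` on `R r` for each `r` and 1-Lipschitz.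
  let f : Plane → ℝ := fun x => ⨅ r, (ψ r + Metric.infDist x (R r).carrier)
  have hbdd : ∀ x, BddBelow (Set.range fun r => ψ r + Metric.infDist x (R r).carrier) :=
    fun x => Set.Finite.bddBelow (Set.finite_range _)
  have hf : LipschitzWith 1 f := by
    refine LipschitzWith.of_le_add fun x y => ?_
    rw [← sub_le_iff_le_add]
    refine le_ciInf fun r => ?_
    have h1 := ciInf_le (hbdd x) r
    have h2 := Metric.infDist_le_infDist_add_dist (s := (R r).carrier) (x := x) (y := y)
    change (⨅ r, (ψ r + Metric.infDist x (R r).carrier)) - _ ≤ _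
    linarith
  have hfc := hf.continuous
  have hQ : ∑ q, (Q q).len * φ q ≤ ∫ x, f x ∂lengthMeasure Q := by
    rw [integral_lengthMeasure Q hfc]
    refine Finset.sum_le_sum fun q _ => mul_le_mul_of_nonneg_left ?_ (Q q).len_nonneg
    have := integral_mono_ae (integrable_const (φ q)) ((Q q).integrable_unif hfc) (by
      filter_upwards [(Q q).ae_mem_carrier] with x hx
      refine le_ciInf fun r => ?_
      rw [← sub_le_iff_le_add']
      exact (Metric.le_infDist ⟨_, (R r).left_mem⟩).2 fun y hy => h q r x hx y hy)
    simpa using this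
  have hR : ∫ x, f x ∂lengthMeasure R ≤ ∑ r, (R r).len * ψ r := by
    rw [integral_lengthMeasure R hfc]
    refine Finset.sum_le_sum fun r _ => mul_le_mul_of_nonneg_left ?_ (R r).len_nonneg
    have := integral_mono_ae ((R r).integrable_unif hfc) (integrable_const (ψ r)) (by
      filter_upwards [(R r).ae_mem_carrier] with x hx
      refine (ciInf_le (hbdd x) r).trans ?_
      simp [Metric.infDist_zero_of_mem hx])
    simpa using this
  have iM := integrable_lengthMeasure M hfc
  have iM' := integrable_lengthMeasure M' hfc
  have iQ := integrable_lengthMeasure Q hfc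
  have iR := integrable_lengthMeasure R hfc
  have e1 : ∫ x, f x ∂lengthMeasure P = ∫ x, f x ∂lengthMeasure M + ∫ x, f x ∂lengthMeasure Q := by
    rw [← hP, integral_add_measure iM iQ]
  have e2 : ∫ x, f x ∂lengthMeasure S =
      ∫ x, f x ∂lengthMeasure M' + ∫ x, f x ∂lengthMeasure R := by
    rw [← hS, integral_add_measure iM' iR]
  have hPS : ‖∫ x, f x ∂lengthMeasure P - ∫ x, f x ∂lengthMeasure S‖ₑ ≤
      emd (lengthMeasure P) (lengthMeasure S) :=
    le_iInf fun π => le_iInf fun hπ => enorm_integral_sub_le_planCost hf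
      (integrable_lengthMeasure P hfc) (integrable_lengthMeasure S hfc) hπ
  have hMM := enorm_integral_sub_le_planCost hf iM iM' hτ
  refine le_trans ?_ (add_le_add hPS hMM)
  rw [Real.enorm_eq_ofReal_abs, Real.enorm_eq_ofReal_abs,
    ← ENNReal.ofReal_add (abs_nonneg _) (abs_nonneg _)]
  refine ENNReal.ofReal_le_ofReal ?_
  have a1 := le_abs_self (∫ x, f x ∂lengthMeasure P - ∫ x, f x ∂lengthMeasure S)
  have a2 := neg_abs_le (∫ x, f x ∂lengthMeasure M - ∫ x, f x ∂lengthMeasure M')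
  linarith

/-- Lower half of the comparison with the discrete problem: every admissible dual value is at most
the right-hand side, so some plan is. The lower bounds `c` may be negative. -/
theorem exists_plan_le_emd {n m kM kM' k l : ℕ} {P : Fin n → Seg} {S : Fin m → Seg}
    {M : Fin kM → Seg} {M' : Fin kM' → Seg} {Q : Fin k → Seg} {R : Fin l → Seg}
    (hP : lengthMeasure M + lengthMeasure Q = lengthMeasure P)
    (hS : lengthMeasure M' + lengthMeasure R = lengthMeasure S)
    {τ : Measure (Plane × Plane)} (hτ : IsTransportPlan (lengthMeasure M) (lengthMeasure M') τ)
    (hQR : ∑ q, (Q q).len = ∑ r, (R r).len) {c : Fin k → Fin l → ℝ}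
    (h : ∀ q r, ∀ x ∈ (Q q).carrier, ∀ y ∈ (R r).carrier, c q r ≤ dist x y) :
    ∃ w, IsDiscretePlan (fun q => (Q q).len) (fun r => (R r).len) w ∧
      ENNReal.ofReal (∑ q, ∑ r, w q r * c q r) ≤
        emd (lengthMeasure P) (lengthMeasure S) + planCost τ := by
  rcases eq_or_ne (emd (lengthMeasure P) (lengthMeasure S) + planCost τ) ⊤ with htop | htop
  · obtain ⟨w, hw⟩ := exists_isDiscretePlan (fun q => (Q q).len_nonneg)
      (fun r => (R r).len_nonneg) hQR
    exact ⟨w, hw, by simp [htop]⟩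
  · obtain ⟨w, hw, hv⟩ := exists_plan_of_forall_dual (fun q => (Q q).len_nonneg)
      (fun r => (R r).len_nonneg) hQR c
      (v := (emd (lengthMeasure P) (lengthMeasure S) + planCost τ).toReal) (by
        intro φ ψ hφ
        exact (ENNReal.ofReal_le_iff_le_toReal htop).1 (ofReal_dual_le_emd hP hS hτ hQR
          fun q r x hx y hy => (hφ q r).trans (h q r x hx y hy)))
    exact ⟨w, hw, (ENNReal.ofReal_le_iff_le_toReal htop).2 hv⟩

theorem IsDiscretePlan.sum_eq {k l : ℕ} {a : Fin k → ℝ} {b : Fin l → ℝ} {w : Fin k → Fin l → ℝ}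
    (h : IsDiscretePlan a b w) : ∑ i, a i = ∑ j, b j := by
  simp only [← h.row, ← h.col]
  exact Finset.sum_comm

/-! ### Cost of the match-and-subdivide construction -/

theorem IsUnitFamily.pos {n : ℕ} {P : Fin n → Seg} (hP : IsUnitFamily P) : 0 < n := by
  rcases Nat.eq_zero_or_pos n with rfl | h
  · simpa using hP.2
  · exact h

theorem MatchSubdivide.isTransportPlan {δ : ℝ} {n m : ℕ} {P : Fin n → Seg} {S : Fin m → Seg}
    (X : MatchSubdivide δ P S) : IsTransportPlan (lengthMeasure P) (lengthMeasure S) X.plan := by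
  rw [← X.subdivide_P, ← X.subdivide_S]
  exact X.τM_plan.add (isTransportPlan_spread _ _ X.ν_plan)

theorem MatchSubdivide.planCost_τM_le {δ : ℝ} {n m : ℕ} {P : Fin n → Seg}
    {S : Fin m → Seg} (hP : IsUnitFamily P) (X : MatchSubdivide δ P S) :
    planCost X.τM ≤ ENNReal.ofReal (δ / ((n : ℝ) * m)) := by
  refine (planCost_le_of_ae X.τM_close).trans ?_
  refine mul_le_of_le_one_right zero_le ?_
  rw [← X.τM_plan.univ_eq.1]
  calc lengthMeasure X.M Set.univ ≤ (lengthMeasure X.M + lengthMeasure X.Q) Set.univ := by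
        rw [Measure.add_apply]; exact le_self_add
    _ = 1 := by rw [X.subdivide_P, lengthMeasure_univ, hP.2, ENNReal.ofReal_one]

/-- The ratio condition is used twice: it bounds the distances within the pieces above by `(1 + δ) *
dist (u q) (v r)` for the cost of the spread plan, and below by `dist (u q) (v r) / (1 + δ)` for the
comparison with EMD. -/
theorem MatchSubdivide.planCost_plan_le {δ : ℝ} (hδ : 0 < δ) (hδ1 : δ ≤ 1) {n m : ℕ}
    {P : Fin n → Seg} {S : Fin m → Seg} (hP : IsUnitFamily P) (X : MatchSubdivide δ P S) :
    planCost X.plan ≤ ENNReal.ofReal (1 + 3 * δ) * emd (lengthMeasure P) (lengthMeasure S)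
      + ENNReal.ofReal (5 * δ / ((n : ℝ) * m)) := by
  have hd : 0 < 1 + δ := by linarith
  have hM := X.planCost_τM_le hP
  set ε := δ / ((n : ℝ) * m) with hε
  have hε0 : 0 ≤ ε := by positivity
  obtain ⟨w, hw, hwc⟩ := exists_plan_le_emd X.subdivide_P X.subdivide_S X.τM_plan
    X.ν_plan.sum_eq (c := fun q r => dist (X.u q) (X.v r) / (1 + δ)) (by
      intro q r x hx y hy
      rw [div_le_iff₀' hd]
      exact X.ratio q r _ (X.u_mem q) _ (X.v_mem r) x hx y hy)
  have h1 := planCost_spread_le X.Q X.R X.ν_plan.nonneg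
    (c := fun q r => (1 + δ) * dist (X.u q) (X.v r)) (fun q r => by positivity)
    (fun q r x hx y hy => X.ratio q r x hx y hy _ (X.u_mem q) _ (X.v_mem r))
  have h2 : ∑ q, ∑ r, X.ν q r * ((1 + δ) * dist (X.u q) (X.v r)) ≤
      (1 + 3 * δ) * ∑ q, ∑ r, w q r * (dist (X.u q) (X.v r) / (1 + δ)) := by
    have h3 := X.ν_optimal w hw
    have e1 : ∑ q, ∑ r, X.ν q r * ((1 + δ) * dist (X.u q) (X.v r)) =
        (1 + δ) * discreteCost X.u X.v X.ν := by
      simp only [discreteCost, Finset.mul_sum]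
      refine Finset.sum_congr rfl fun q _ => Finset.sum_congr rfl fun r _ => by ring
    have e2 : ∑ q, ∑ r, w q r * (dist (X.u q) (X.v r) / (1 + δ)) =
        discreteCost X.u X.v w / (1 + δ) := by
      simp only [discreteCost, Finset.sum_div, mul_div_assoc]
    have h0 : 0 ≤ discreteCost X.u X.v w :=
      Finset.sum_nonneg fun q _ => Finset.sum_nonneg fun r _ =>
        mul_nonneg (hw.nonneg q r) dist_nonneg
    rw [e1, e2, mul_div_assoc', le_div_iff₀ hd]
    -- This is `(1 + δ)² ≤ 1 + 3δ`, valid for `δ ≤ 1`.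
    nlinarith [mul_le_mul_of_nonneg_left h3 (mul_pos hd hd).le,
      mul_nonneg (mul_nonneg hδ.le (sub_nonneg.2 hδ1)) h0]
  calc planCost X.plan = planCost X.τM + planCost (spread X.Q X.R X.ν) := planCost_add _ _
    _ ≤ ENNReal.ofReal ε + ENNReal.ofReal (1 + 3 * δ) *
          (emd (lengthMeasure P) (lengthMeasure S) + ENNReal.ofReal ε) := by
        refine add_le_add hM (h1.trans ((ENNReal.ofReal_le_ofReal h2).trans ?_))
        rw [ENNReal.ofReal_mul (by linarith)]
        exact mul_le_mul_right (hwc.trans (add_le_add le_rfl hM)) _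
    _ = ENNReal.ofReal (1 + 3 * δ) * emd (lengthMeasure P) (lengthMeasure S) +
          ENNReal.ofReal (ε + (1 + 3 * δ) * ε) := by
        rw [mul_add, ENNReal.ofReal_add hε0 (by positivity),
          ENNReal.ofReal_mul (p := 1 + 3 * δ) (by linarith)]
        ring
    _ ≤ _ := by
        -- The cost `ε` of the matching occurs once directly and `1 + 3δ ≤ 4` times through the
        -- comparison.
        refine add_le_add le_rfl (ENNReal.ofReal_le_ofReal ?_)
        rw [mul_div_assoc, ← hε]
        nlinarith

/-! ### Existence of a match-and-subdivide construction -/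

/-- The mass distribution of a multiset of segments. -/
noncomputable def multisetMeasure (L : Multiset Seg) : Measure Plane := (L.map Seg.meas).sum

@[simp] theorem multisetMeasure_zero : multisetMeasure 0 = 0 := by simp [multisetMeasure]

@[simp] theorem multisetMeasure_cons (s : Seg) (L : Multiset Seg) :
    multisetMeasure (s ::ₘ L) = s.meas + multisetMeasure L := by simp [multisetMeasure]

theorem lengthMeasure_get (L : List Seg) :
    lengthMeasure L.get = multisetMeasure (L : Multiset Seg) := by
  rw [lengthMeasure_eq_sum, multisetMeasure, Multiset.map_coe, Multiset.sum_coe,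
    ← Fin.sum_univ_fun_getElem]
  rfl

/-- Pieces of length exactly `g` are cut off until at most `g` is left; `k` serves only as a bound
for the induction. -/
theorem Seg.exists_cut {g : ℝ} (hg : 0 < g) (k : ℕ) : ∀ s : Seg, s.len ≤ k * g →
    ∃ L : Multiset Seg, (∀ q ∈ L, q.len ≤ g) ∧ multisetMeasure L = s.meas ∧
      (L.card : ℝ) ≤ s.len / g + 1 := by
  induction k with
  | zero =>
    intro s hs
    refine ⟨{s}, by simpa using by simp at hs; linarith, by simp [multisetMeasure], ?_⟩
    have := div_nonneg s.len_nonneg hg.le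
    simpa
  | succ k ih =>
    intro s hs
    rcases le_or_gt s.len g with h | h
    · refine ⟨{s}, by simpa using h, by simp [multisetMeasure], ?_⟩
      have := div_nonneg s.len_nonneg hg.le
      simpa
    have hl : 0 < s.len := hg.trans h
    have h0 : 0 ≤ g / s.len := by positivity
    have h1 : g / s.len ≤ 1 := (div_le_one hl).2 h.le
    have e1 : (s.part 0 (g / s.len)).len = g := by
      rw [s.part_len h0, sub_zero, div_mul_cancel₀ _ hl.ne']
    have e2 : (s.part (g / s.len) 1).len = s.len - g := by
      rw [s.part_len h1, sub_mul, div_mul_cancel₀ _ hl.ne', one_mul]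
    obtain ⟨L, hL1, hL2, hL3⟩ := ih (s.part (g / s.len) 1) (by
      rw [e2]; push_cast at hs; linarith)
    refine ⟨s.part 0 (g / s.len) ::ₘ L, ?_, ?_, ?_⟩
    · intro q hq
      rcases Multiset.mem_cons.1 hq with rfl | hq
      · exact e1.le
      · exact hL1 q hq
    · rw [multisetMeasure_cons, hL2, s.meas_split h0 h1]
    · rw [e2, sub_div, div_self hg.ne'] at hL3
      rw [Multiset.card_cons]
      push_cast
      linarith

theorem exists_cut_family {g : ℝ} (hg : 0 < g) {n : ℕ} (P : Fin n → Seg) :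
    ∃ L : Multiset Seg, (∀ q ∈ L, q.len ≤ g) ∧ multisetMeasure L = lengthMeasure P ∧
      (L.card : ℝ) ≤ (∑ i, (P i).len) / g + n := by
  have h : ∀ s : Seg, ∃ L : Multiset Seg, (∀ q ∈ L, q.len ≤ g) ∧ multisetMeasure L = s.meas ∧
      (L.card : ℝ) ≤ s.len / g + 1 := fun s => by
    obtain ⟨k, hk⟩ := exists_nat_ge (s.len / g)
    exact s.exists_cut hg k ((div_le_iff₀ hg).1 hk)
  choose L h1 h2 h3 using h
  refine ⟨∑ i, L (P i), ?_, ?_, ?_⟩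
  · intro q hq
    obtain ⟨i, -, hi⟩ := Multiset.mem_sum.1 hq
    exact h1 _ q hi
  · exact (map_sum (Multiset.sumAddMonoidHom.comp (Multiset.mapAddMonoidHom Seg.meas))
      (fun i => L (P i)) Finset.univ).trans (Finset.sum_congr rfl fun i _ => h2 (P i))
  · rw [Multiset.card_sum, Finset.sum_div]
    push_cast
    calc ∑ i, ((L (P i)).card : ℝ) ≤ ∑ i, ((P i).len / g + 1) :=
          Finset.sum_le_sum fun i _ => h3 (P i)
      _ = _ := by simp [Finset.sum_add_distrib]

/-! ### Greedy matching of close pieces -/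

/-- The longest distance between the two segments is at most `1 + δ` times the shortest. -/
def RatioLE (δ : ℝ) (q r : Seg) : Prop :=
  ∀ x ∈ q.carrier, ∀ y ∈ r.carrier, ∀ x' ∈ q.carrier, ∀ y' ∈ r.carrier,
    dist x y ≤ (1 + δ) * dist x' y'

/-- Distances between the two pieces differ by at most `2g`. If two of them have a ratio above `1 +
δ`, then `δ` times the smaller one is below `2g`. -/
theorem dist_le_of_not_ratioLE {δ g : ℝ} (hδ : 0 < δ) {q r : Seg} (hq : q.len ≤ g)
    (hr : r.len ≤ g) (h : ¬ RatioLE δ q r) {x y : Plane} (hx : x ∈ q.carrier)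
    (hy : y ∈ r.carrier) : dist x y ≤ 2 * g / δ + 2 * g := by
  simp only [RatioLE, not_forall, not_le] at h
  obtain ⟨x₁, hx₁, y₁, hy₁, x₂, hx₂, y₂, hy₂, h⟩ := h
  have key : ∀ {x y}, x ∈ q.carrier → y ∈ r.carrier → dist x y ≤ dist x₂ y₂ + 2 * g := by
    intro x y hx hy
    have h1 := q.dist_le_len hx hx₂
    have h2 := r.dist_le_len hy₂ hy
    have h3 := dist_triangle4 x x₂ y₂ y
    linarith
  have h1 := key hx₁ hy₁
  have h2 : dist x₂ y₂ ≤ 2 * g / δ := by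
    rw [le_div_iff₀ hδ]
    linarith
  linarith [key hx hy]

theorem ae_dist_le_smul_prod {q r q' r' : Seg} (hq : q'.carrier ⊆ q.carrier)
    (hr : r'.carrier ⊆ r.carrier) {c : ℝ} (h : ∀ x ∈ q.carrier, ∀ y ∈ r.carrier, dist x y ≤ c)
    (a : ℝ≥0∞) : ∀ᵐ z ∂(a • q'.unif.prod r'.unif), dist z.1 z.2 ≤ c := by
  refine Measure.ae_smul_measure ?_ a
  filter_upwards [ae_prod_mem q' r'] with z hz using h _ (hq hz.1) _ (hr hz.2)

/-- As long as some pair violates the ratio condition, it is close, and the shorter piece is matched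
entirely with an initial part of the longer one. One piece disappears and the other is replaced by
its rest, so the number of pieces drops by one in each round. -/
theorem exists_greedy_matching {δ g : ℝ} (hδ : 0 < δ) (N : ℕ) : ∀ Q R : Multiset Seg,
    Q.card + R.card ≤ N → (∀ q ∈ Q, q.len ≤ g) → (∀ r ∈ R, r.len ≤ g) →
    ∃ (M M' Q' R' : Multiset Seg) (τ : Measure (Plane × Plane)),
      multisetMeasure M + multisetMeasure Q' = multisetMeasure Q ∧
      multisetMeasure M' + multisetMeasure R' = multisetMeasure R ∧
      IsTransportPlan (multisetMeasure M) (multisetMeasure M') τ ∧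
      (∀ᵐ z ∂τ, dist z.1 z.2 ≤ 2 * g / δ + 2 * g) ∧
      (∀ q ∈ Q', ∀ r ∈ R', RatioLE δ q r) ∧ Q'.card + R'.card ≤ N := by
  induction N with
  | zero =>
    intro Q R h _ _
    obtain rfl : Q = 0 := Multiset.card_eq_zero.1 (by omega)
    obtain rfl : R = 0 := Multiset.card_eq_zero.1 (by omega)
    exact ⟨0, 0, 0, 0, 0, by simp, by simp, by simpa using isTransportPlan_zero, by simp,
      by simp, by simp⟩
  | succ N ih =>
    intro Q R hcard hQ hR
    by_cases hall : ∀ q ∈ Q, ∀ r ∈ R, RatioLE δ q r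
    · exact ⟨0, 0, Q, R, 0, by simp, by simp, by simpa using isTransportPlan_zero, by simp,
        hall, hcard⟩
    push Not at hall
    obtain ⟨q, hq, r, hr, hqr⟩ := hall
    have hclose : ∀ x ∈ q.carrier, ∀ y ∈ r.carrier, dist x y ≤ 2 * g / δ + 2 * g :=
      fun x hx y hy => dist_le_of_not_ratioLE hδ (hQ q hq) (hR r hr) hqr hx hy
    obtain ⟨Q, rfl⟩ := Multiset.exists_cons_of_mem hq
    obtain ⟨R, rfl⟩ := Multiset.exists_cons_of_mem hr
    simp only [Multiset.card_cons] at hcard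
    simp only [Multiset.mem_cons, forall_eq_or_imp] at hQ hR
    rcases le_or_gt q.len r.len with hle | hlt
    · set t := q.len / r.len
      have h0 : 0 ≤ t := div_nonneg q.len_nonneg r.len_nonneg
      have h1 : t ≤ 1 := div_le_one_of_le₀ hle r.len_nonneg
      have hlen : (r.part 0 t).len = q.len := by
        rw [r.part_len h0, sub_zero]
        -- If `r` is degenerate then so is `q`, and `t = 0 / 0 = 0` still gives a part of the right
        -- length.
        refine div_mul_cancel_of_imp fun h => le_antisymm (h ▸ hle) q.len_nonneg
      have hlen2 : (r.part t 1).len ≤ g := by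
        rw [r.part_len h1]
        nlinarith [r.len_nonneg]
      obtain ⟨M, M', Q', R', τ, hM, hM', hτ, hτc, hrat, hc⟩ := ih Q (r.part t 1 ::ₘ R)
        (by simp only [Multiset.card_cons]; omega) hQ.2
        (by simpa only [Multiset.mem_cons, forall_eq_or_imp] using ⟨hlen2, hR.2⟩)
      refine ⟨q ::ₘ M, r.part 0 t ::ₘ M', Q', R',
        ENNReal.ofReal q.len • q.unif.prod (r.part 0 t).unif + τ, ?_, ?_, ?_, ?_, hrat, by omega⟩
      · simp only [multisetMeasure_cons, add_assoc, hM]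
      · simp only [multisetMeasure_cons, add_assoc, hM', ← r.meas_split h0 h1]
      · simp only [multisetMeasure_cons]
        refine IsTransportPlan.add ?_ hτ
        have := isTransportPlan_smul_prod (ENNReal.ofReal q.len) q (r.part 0 t)
        rwa [Seg.meas, Seg.meas, hlen]
      · exact ae_add_measure_iff.2 ⟨ae_dist_le_smul_prod subset_rfl
          (r.part_carrier_subset le_rfl h1 h0) hclose _, hτc⟩
    · set t := r.len / q.len
      have h0 : 0 ≤ t := div_nonneg r.len_nonneg q.len_nonneg
      have h1 : t ≤ 1 := div_le_one_of_le₀ hlt.le q.len_nonneg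
      have hlen : (q.part 0 t).len = r.len := by
        rw [q.part_len h0, sub_zero]
        exact div_mul_cancel₀ _ (r.len_nonneg.trans_lt hlt).ne'
      have hlen2 : (q.part t 1).len ≤ g := by
        rw [q.part_len h1]
        nlinarith [q.len_nonneg]
      obtain ⟨M, M', Q', R', τ, hM, hM', hτ, hτc, hrat, hc⟩ := ih (q.part t 1 ::ₘ Q) R
        (by simp only [Multiset.card_cons]; omega)
        (by simpa only [Multiset.mem_cons, forall_eq_or_imp] using ⟨hlen2, hQ.2⟩) hR.2
      refine ⟨q.part 0 t ::ₘ M, r ::ₘ M', Q', R',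
        ENNReal.ofReal r.len • (q.part 0 t).unif.prod r.unif + τ, ?_, ?_, ?_, ?_, hrat, by omega⟩
      · simp only [multisetMeasure_cons, add_assoc, hM, ← q.meas_split h0 h1]
      · simp only [multisetMeasure_cons, add_assoc, hM']
      · simp only [multisetMeasure_cons]
        refine IsTransportPlan.add ?_ hτ
        have := isTransportPlan_smul_prod (ENNReal.ofReal r.len) (q.part 0 t) r
        rwa [Seg.meas, Seg.meas, hlen]
      · exact ae_add_measure_iff.2 ⟨ae_dist_le_smul_prod (q.part_carrier_subset le_rfl h1 h0)
          subset_rfl hclose _, hτc⟩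

/-- The matched parts have equal mass, so what is left over has equal mass too. -/
theorem sum_len_eq_of_isTransportPlan {n m kM kM' k l : ℕ} {P : Fin n → Seg}
    {S : Fin m → Seg} {M : Fin kM → Seg} {M' : Fin kM' → Seg} {Q : Fin k → Seg} {R : Fin l → Seg}
    (hP : lengthMeasure M + lengthMeasure Q = lengthMeasure P)
    (hS : lengthMeasure M' + lengthMeasure R = lengthMeasure S)
    {τ : Measure (Plane × Plane)} (hτ : IsTransportPlan (lengthMeasure M) (lengthMeasure M') τ)
    (hPS : ∑ i, (P i).len = ∑ j, (S j).len) :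
    ∑ q, (Q q).len = ∑ r, (R r).len := by
  have h0 : ∀ {k : ℕ} (Q : Fin k → Seg), 0 ≤ ∑ q, (Q q).len :=
    fun Q => Finset.sum_nonneg fun q _ => (Q q).len_nonneg
  have e1 := congrArg (· Set.univ) hP
  have e2 := congrArg (· Set.univ) hS
  have e3 := hτ.univ_eq.1.trans hτ.univ_eq.2.symm
  simp only [Measure.add_apply, lengthMeasure_univ] at e1 e2 e3
  rw [← ENNReal.ofReal_add (h0 _) (h0 _),
    ENNReal.ofReal_eq_ofReal_iff (add_nonneg (h0 _) (h0 _)) (h0 _)] at e1 e2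
  rw [ENNReal.ofReal_eq_ofReal_iff (h0 _) (h0 _)] at e3
  linarith

theorem exists_matchSubdivide {δ : ℝ} (hδ : 0 < δ) (hδ1 : δ ≤ 1) {n m : ℕ} {P : Fin n → Seg}
    {S : Fin m → Seg} (hP : IsUnitFamily P) (hS : IsUnitFamily S) :
    ∃ X : MatchSubdivide δ P S,
      ((X.numQ + X.numR : ℕ) : ℝ) ≤ 10 * ((n : ℝ) * m) / δ ^ 2 := by
  have hn : (1 : ℝ) ≤ n := by exact_mod_cast hP.pos
  have hm : (1 : ℝ) ≤ m := by exact_mod_cast hS.pos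
  have hnm : (0 : ℝ) < n * m := by positivity
  -- Chosen so that violating pairs are at distance at most `2g/δ + 2g = (δ / (nm)) * ((1 + δ) / 2)
  -- ≤ δ / (nm)`.
  set g : ℝ := δ ^ 2 / (4 * (n * m)) with hgdef
  have hg : 0 < g := by positivity
  obtain ⟨Q₀, hQ1, hQ2, hQ3⟩ := exists_cut_family hg P
  obtain ⟨R₀, hR1, hR2, hR3⟩ := exists_cut_family hg S
  obtain ⟨M, M', Q, R, τ, hM, hM', hτ, hτc, hrat, hc⟩ :=
    exists_greedy_matching hδ _ Q₀ R₀ le_rfl hQ1 hR1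
  have hclose : 2 * g / δ + 2 * g ≤ δ / ((n : ℝ) * m) := by
    have e : 2 * g / δ + 2 * g = (δ / (n * m)) * ((1 + δ) / 2) := by
      rw [hgdef]; field_simp; ring
    rw [e]
    exact mul_le_of_le_one_right (by positivity) (by linarith)
  have hl : ∀ L : Multiset Seg, lengthMeasure L.toList.get = multisetMeasure L := fun L => by
    rw [lengthMeasure_get, Multiset.coe_toList]
  have hsP : lengthMeasure M.toList.get + lengthMeasure Q.toList.get = lengthMeasure P := by
    rw [hl, hl, hM, hQ2]
  have hsS : lengthMeasure M'.toList.get + lengthMeasure R.toList.get = lengthMeasure S := by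
    rw [hl, hl, hM', hR2]
  have hτ' : IsTransportPlan (lengthMeasure M.toList.get) (lengthMeasure M'.toList.get) τ := by
    rwa [hl, hl]
  have hsum := sum_len_eq_of_isTransportPlan hsP hsS hτ' (hP.2.trans hS.2.symm)
  obtain ⟨ν, hν, hopt⟩ := exists_optimal_plan (fun q => (Q.toList.get q).len_nonneg)
    (fun r => (R.toList.get r).len_nonneg) hsum
    (fun q r => dist (Q.toList.get q).a (R.toList.get r).a)
  refine ⟨{ numM := _, numM' := _, numQ := _, numR := _
            M := M.toList.get, M' := M'.toList.get, Q := Q.toList.get, R := R.toList.get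
            subdivide_P := hsP, subdivide_S := hsS, τM := τ, τM_plan := hτ'
            τM_close := by filter_upwards [hτc] with z hz using hz.trans hclose
            ratio := fun q r => hrat _ (Multiset.mem_toList.1 (List.get_mem _ _)) _
              (Multiset.mem_toList.1 (List.get_mem _ _))
            u := fun q => (Q.toList.get q).a, v := fun r => (R.toList.get r).a
            u_mem := fun q => Seg.left_mem _, v_mem := fun r => Seg.left_mem _
            ν := ν, ν_plan := hν, ν_optimal := hopt }, ?_⟩
  simp only [Multiset.length_toList]
  have h1 : ((Q.card + R.card : ℕ) : ℝ) ≤ Q₀.card + R₀.card := by exact_mod_cast hc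
  refine h1.trans ((add_le_add hQ3 hR3).trans ?_)
  rw [hP.2, hS.2]
  have e : 1 / g = 4 * (n * m) / δ ^ 2 := by rw [hgdef]; field_simp
  have h2 : (n : ℝ) * m ≤ n * m / δ ^ 2 := by
    rw [le_div_iff₀ (by positivity)]
    exact mul_le_of_le_one_right hnm.le (pow_le_one₀ hδ.le hδ1)
  have h3 : 10 * ((n : ℝ) * m) / δ ^ 2 = 10 * (n * m / δ ^ 2) := by ring
  have h4 : 4 * ((n : ℝ) * m) / δ ^ 2 = 4 * (n * m / δ ^ 2) := by ring
  rw [e, h3, h4]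
  -- There are at most `2/g + n + m ≤ 8nm/δ² + 2nm` pieces.
  nlinarith

/-! ### Reasoning about programs -/

namespace RAMState

@[simp] theorem nreg_setN (s : RAMState) (d v r : ℕ) :
    (s.setN d v).nreg r = if r = d then v else s.nreg r := by
  simp [setN, Function.update_apply]
@[simp] theorem rreg_setN (s : RAMState) (d v : ℕ) : (s.setN d v).rreg = s.rreg := rfl
@[simp] theorem narr_setN (s : RAMState) (d v : ℕ) : (s.setN d v).narr = s.narr := rfl
@[simp] theorem rarr_setN (s : RAMState) (d v : ℕ) : (s.setN d v).rarr = s.rarr := rfl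
@[simp] theorem drawn_setN (s : RAMState) (d v : ℕ) : (s.setN d v).drawn = s.drawn := rfl

@[simp] theorem rreg_setR (s : RAMState) (d : ℕ) (v : ℝ) (r : ℕ) :
    (s.setR d v).rreg r = if r = d then v else s.rreg r := by
  simp [setR, Function.update_apply]
@[simp] theorem nreg_setR (s : RAMState) (d : ℕ) (v : ℝ) : (s.setR d v).nreg = s.nreg := rfl
@[simp] theorem narr_setR (s : RAMState) (d : ℕ) (v : ℝ) : (s.setR d v).narr = s.narr := rfl
@[simp] theorem rarr_setR (s : RAMState) (d : ℕ) (v : ℝ) : (s.setR d v).rarr = s.rarr := rfl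
@[simp] theorem drawn_setR (s : RAMState) (d : ℕ) (v : ℝ) : (s.setR d v).drawn = s.drawn := rfl

@[simp] theorem narr_setNArr (s : RAMState) (a i v A e : ℕ) :
    (s.setNArr a i v).narr A e = if A = a ∧ e = i then v else s.narr A e := by
  simp only [setNArr, Function.update_apply]
  split_ifs <;> simp_all
@[simp] theorem nreg_setNArr (s : RAMState) (a i v : ℕ) : (s.setNArr a i v).nreg = s.nreg := rfl
@[simp] theorem rreg_setNArr (s : RAMState) (a i v : ℕ) : (s.setNArr a i v).rreg = s.rreg := rfl
@[simp] theorem rarr_setNArr (s : RAMState) (a i v : ℕ) : (s.setNArr a i v).rarr = s.rarr := rfl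
@[simp] theorem drawn_setNArr (s : RAMState) (a i v : ℕ) :
    (s.setNArr a i v).drawn = s.drawn := rfl

@[simp] theorem rarr_setRArr (s : RAMState) (a i : ℕ) (v : ℝ) (A e : ℕ) :
    (s.setRArr a i v).rarr A e = if A = a ∧ e = i then v else s.rarr A e := by
  simp only [setRArr, Function.update_apply]
  split_ifs <;> simp_all
@[simp] theorem nreg_setRArr (s : RAMState) (a i : ℕ) (v : ℝ) :
    (s.setRArr a i v).nreg = s.nreg := rfl
@[simp] theorem rreg_setRArr (s : RAMState) (a i : ℕ) (v : ℝ) :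
    (s.setRArr a i v).rreg = s.rreg := rfl
@[simp] theorem narr_setRArr (s : RAMState) (a i : ℕ) (v : ℝ) :
    (s.setRArr a i v).narr = s.narr := rfl
@[simp] theorem drawn_setRArr (s : RAMState) (a i : ℕ) (v : ℝ) :
    (s.setRArr a i v).drawn = s.drawn := rfl

end RAMState

/-! #### Registers and arrays that a program does not write -/

def Instr.WritesN (r : ℕ) : Instr → Prop
  | .nconst d _ | .nadd d _ _ | .nsub d _ _ | .nload d _ _ => r = d
  | _ => False

def Instr.WritesR (r : ℕ) : Instr → Prop
  | .rcast d _ | .radd d _ _ | .rsub d _ _ | .rmul d _ _ | .rdiv d _ _ | .rsqrt d _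
  | .rload d _ _ | .rand d => r = d
  | _ => False

def Instr.WritesNArr (A : ℕ) : Instr → Prop
  | .nstore a _ _ => A = a
  | _ => False

def Instr.WritesRArr (A : ℕ) : Instr → Prop
  | .rstore a _ _ => A = a
  | _ => False

def Instr.IsRand : Instr → Prop
  | .rand _ => True
  | _ => False

/-- Some instruction of the program has the property. -/
def Prog.Has (c : Instr → Prop) : Prog → Prop
  | .basic i => c i
  | .seq p q => p.Has c ∨ q.Has c
  | .ite _ p q => p.Has c ∨ q.Has c
  | .loop _ p => p.Has c

/-- The states agree on everything that the program does not write. -/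
structure Unchanged (p : Prog) (s s' : RAMState) : Prop where
  nreg : ∀ r, ¬ p.Has (Instr.WritesN r) → s'.nreg r = s.nreg r
  rreg : ∀ r, ¬ p.Has (Instr.WritesR r) → s'.rreg r = s.rreg r
  narr : ∀ r, ¬ p.Has (Instr.WritesNArr r) → s'.narr r = s.narr r
  rarr : ∀ r, ¬ p.Has (Instr.WritesRArr r) → s'.rarr r = s.rarr r
  drawn : ¬ p.Has Instr.IsRand → s'.drawn = s.drawn

theorem Unchanged.refl (p : Prog) (s : RAMState) : Unchanged p s s :=
  ⟨fun _ _ => rfl, fun _ _ => rfl, fun _ _ => rfl, fun _ _ => rfl, fun _ => rfl⟩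

theorem Unchanged.trans {p : Prog} {s s' s'' : RAMState} (h : Unchanged p s s')
    (h' : Unchanged p s' s'') : Unchanged p s s'' :=
  ⟨fun r hr => (h'.nreg r hr).trans (h.nreg r hr), fun r hr => (h'.rreg r hr).trans (h.rreg r hr),
    fun r hr => (h'.narr r hr).trans (h.narr r hr), fun r hr => (h'.rarr r hr).trans (h.rarr r hr),
    fun hr => (h'.drawn hr).trans (h.drawn hr)⟩

theorem Unchanged.mono {p q : Prog} (hpq : ∀ c, p.Has c → q.Has c) {s s' : RAMState}
    (h : Unchanged p s s') : Unchanged q s s' :=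
  ⟨fun r hr => h.nreg r fun h => hr (hpq _ h), fun r hr => h.rreg r fun h => hr (hpq _ h),
    fun r hr => h.narr r fun h => hr (hpq _ h), fun r hr => h.rarr r fun h => hr (hpq _ h),
    fun hr => h.drawn fun h => hr (hpq _ h)⟩

theorem Instr.unchanged (ω : RandomTape) (i : Instr) (s : RAMState) :
    Unchanged (.basic i) s (i.apply ω s) := by
  constructor
  · intro r hr
    cases i <;> simp_all [Instr.apply, Prog.Has, Instr.WritesN]
  · intro r hr
    cases i <;> simp_all [Instr.apply, Prog.Has, Instr.WritesR]
  · intro r hr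
    ext e
    cases i <;> simp_all [Instr.apply, Prog.Has, Instr.WritesNArr]
  · intro r hr
    ext e
    cases i <;> simp_all [Instr.apply, Prog.Has, Instr.WritesRArr]
  · intro hr
    cases i <;> simp_all [Instr.apply, Prog.Has, Instr.IsRand]

theorem Exec.unchanged {ω : RandomTape} {p : Prog} {s s' : RAMState} {t : ℕ}
    (h : Exec ω p s s' t) : Unchanged p s s' := by
  induction h with
  | basic i s => exact i.unchanged ω s
  | seq _ _ ih ih' => exact (ih.mono fun _ => Or.inl).trans (ih'.mono fun _ => Or.inr)
  | ite_pos _ _ ih => exact ih.mono fun _ => Or.inl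
  | ite_neg _ _ ih => exact ih.mono fun _ => Or.inr
  | loop_stop _ => exact Unchanged.refl _ _
  | @loop_step c p _ _ _ _ _ _ _ _ ih ih' =>
    exact Unchanged.trans (Unchanged.mono (p := p) (q := .loop c p) (fun _ h => h) ih) ih'

/-! #### A program uses only finitely many registers and arrays -/

/-- A bound for the registers and arrays that an instruction mentions. -/
def Instr.bound : Instr → ℕ
  | .nconst d _ => d + 1
  | .nadd d x y | .nsub d x y | .nload d x y | .nstore d x y | .radd d x y | .rsub d x y
  | .rmul d x y | .rdiv d x y | .rload d x y | .rstore d x y => d + x + y + 1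
  | .rcast d x | .rsqrt d x => d + x + 1
  | .rand d => d + 1

def Test.bound : Test → ℕ
  | .nlt x y | .rlt x y => x + y + 1

def Prog.bound : Prog → ℕ
  | .basic i => i.bound
  | .seq p q => p.bound + q.bound
  | .ite c p q => c.bound + p.bound + q.bound
  | .loop c p => c.bound + p.bound

/-- The states agree on registers and arrays with numbers below `b`. -/
structure AgreeBelow (b : ℕ) (s s' : RAMState) : Prop where
  nreg : ∀ r < b, s'.nreg r = s.nreg r
  rreg : ∀ r < b, s'.rreg r = s.rreg r
  narr : ∀ r < b, ∀ e, s'.narr r e = s.narr r e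
  rarr : ∀ r < b, ∀ e, s'.rarr r e = s.rarr r e
  drawn : s'.drawn = s.drawn

theorem AgreeBelow.apply {b : ℕ} {s σ : RAMState} (h : AgreeBelow b s σ) (ω : RandomTape)
    (i : Instr) (hi : i.bound ≤ b) : AgreeBelow b (i.apply ω s) (i.apply ω σ) := by
  obtain ⟨h1, h2, h3, h4, h5⟩ := h
  cases i with
  | nconst d c => exact ⟨by simp +contextual [Instr.apply, h1], h2, h3, h4, h5⟩
  | rand d =>
    refine ⟨h1, fun r hr => ?_, h3, h4, by simp [Instr.apply, h5]⟩
    change (RAMState.setR σ d _).rreg r = (RAMState.setR s d _).rreg r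
    simp [h5, h2 r hr]
  | rcast d x =>
    simp only [Instr.bound] at hi
    have := h1 x (by omega)
    exact ⟨h1, by simp +contextual [Instr.apply, h2, this], h3, h4, h5⟩
  | rsqrt d x =>
    simp only [Instr.bound] at hi
    have := h2 x (by omega)
    exact ⟨h1, by simp +contextual [Instr.apply, h2, this], h3, h4, h5⟩
  | nadd d x y | nsub d x y =>
    simp only [Instr.bound] at hi
    have := h1 x (by omega)
    have := h1 y (by omega)
    exact ⟨by simp +contextual [Instr.apply, *], h2, h3, h4, h5⟩
  | nload d x y =>
    simp only [Instr.bound] at hi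
    have := h3 x (by omega)
    have := h1 y (by omega)
    exact ⟨by simp +contextual [Instr.apply, *], h2, h3, h4, h5⟩
  | radd d x y | rsub d x y | rmul d x y | rdiv d x y =>
    simp only [Instr.bound] at hi
    have := h2 x (by omega)
    have := h2 y (by omega)
    exact ⟨h1, by simp +contextual [Instr.apply, *], h3, h4, h5⟩
  | rload d x y =>
    simp only [Instr.bound] at hi
    have := h4 x (by omega)
    have := h1 y (by omega)
    exact ⟨h1, by simp +contextual [Instr.apply, *], h3, h4, h5⟩
  | nstore d x y =>
    simp only [Instr.bound] at hi
    have := h1 x (by omega)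
    have := h1 y (by omega)
    exact ⟨h1, h2, by simp +contextual [Instr.apply, *], h4, h5⟩
  | rstore d x y =>
    simp only [Instr.bound] at hi
    have := h1 x (by omega)
    have := h2 y (by omega)
    exact ⟨h1, h2, h3, by simp +contextual [Instr.apply, *], h5⟩

theorem AgreeBelow.holds_iff {b : ℕ} {s σ : RAMState} (h : AgreeBelow b s σ) (c : Test)
    (hc : c.bound ≤ b) : c.holds σ ↔ c.holds s := by
  cases c with
  | nlt x y =>
    simp only [Test.bound] at hc
    simp only [Test.holds, h.nreg x (by omega), h.nreg y (by omega)]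
  | rlt x y =>
    simp only [Test.bound] at hc
    simp only [Test.holds, h.rreg x (by omega), h.rreg y (by omega)]

/-- What `A` does depends only on what it can mention. This lets `A` run as a subroutine beside
foreign data, with the same tape, time and answer as on a genuine point input. -/
theorem Exec.agreeBelow {ω : RandomTape} {p : Prog} {s s' : RAMState} {t : ℕ}
    (h : Exec ω p s s' t) {b : ℕ} (hb : p.bound ≤ b) {σ : RAMState} (hσ : AgreeBelow b s σ) :
    ∃ σ', Exec ω p σ σ' t ∧ AgreeBelow b s' σ' := by
  induction h generalizing σ with
  | basic i s => exact ⟨_, .basic i σ, hσ.apply ω i hb⟩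
  | seq _ _ ih ih' =>
    simp only [Prog.bound] at hb
    obtain ⟨σ₁, h1, h2⟩ := ih (by omega) hσ
    obtain ⟨σ₂, h3, h4⟩ := ih' (by omega) h2
    exact ⟨σ₂, .seq h1 h3, h4⟩
  | ite_pos hc _ ih =>
    simp only [Prog.bound] at hb
    obtain ⟨σ₁, h1, h2⟩ := ih (by omega) hσ
    exact ⟨σ₁, .ite_pos ((hσ.holds_iff _ (by omega)).2 hc) h1, h2⟩
  | ite_neg hc _ ih =>
    simp only [Prog.bound] at hb
    obtain ⟨σ₁, h1, h2⟩ := ih (by omega) hσ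
    exact ⟨σ₁, .ite_neg (fun h => hc ((hσ.holds_iff _ (by omega)).1 h)) h1, h2⟩
  | loop_stop hc =>
    simp only [Prog.bound] at hb
    exact ⟨σ, Exec.loop_stop (fun h => hc ((hσ.holds_iff _ (by omega)).1 h)), hσ⟩
  | loop_step hc _ _ ih ih' =>
    have hb' := hb
    simp only [Prog.bound] at hb'
    obtain ⟨σ₁, h1, h2⟩ := ih (by omega) hσ
    obtain ⟨σ₂, h3, h4⟩ := ih' hb h2
    exact ⟨σ₂, .loop_step ((hσ.holds_iff _ (by omega)).2 hc) h1 h3, h4⟩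

theorem Instr.lt_bound (i : Instr) {r : ℕ}
    (h : i.WritesN r ∨ i.WritesR r ∨ i.WritesNArr r ∨ i.WritesRArr r) : r < i.bound := by
  cases i <;> simp_all [Instr.WritesN, Instr.WritesR, Instr.WritesNArr, Instr.WritesRArr,
    Instr.bound] <;> omega

theorem Prog.lt_bound {c : Instr → Prop} {r : ℕ} (hc : ∀ i, c i → r < i.bound) (p : Prog)
    (h : p.Has c) : r < p.bound := by
  induction p with
  | basic i => exact hc i h
  | seq p q ihp ihq =>
    simp only [Prog.bound]
    rcases h with h | h
    · have := ihp h; omega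
    · have := ihq h; omega
  | ite t p q ihp ihq =>
    simp only [Prog.bound]
    rcases h with h | h
    · have := ihp h; omega
    · have := ihq h; omega
  | loop t p ih =>
    simp only [Prog.bound]
    have := ih h; omega

/-! #### Time-bounded Hoare logic for programs without random choices -/

/-- Whatever the random numbers, the program, started in the state `s`, halts within `T` steps in
a state (which does not depend on the random numbers) that satisfies `Φ`. -/
def Within (p : Prog) (s : RAMState) (T : ℕ) (Φ : RAMState → Prop) : Prop :=
  ∃ s' t, (∀ ω, Exec ω p s s' t) ∧ t ≤ T ∧ Φ s'

theorem Within.mono {p : Prog} {s : RAMState} {T T' : ℕ} {Φ Ψ : RAMState → Prop}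
    (h : Within p s T Φ) (hT : T ≤ T') (hΦ : ∀ s', Unchanged p s s' → Φ s' → Ψ s') :
    Within p s T' Ψ := by
  obtain ⟨s', t, h1, h2, h3⟩ := h
  -- Any tape serves here, since the final state is the same for all of them.
  exact ⟨s', t, h1, h2.trans hT, hΦ s' (h1 fun _ => 0).unchanged h3⟩

theorem Within.seq {p q : Prog} {s : RAMState} {T T' : ℕ} {Φ Ψ : RAMState → Prop}
    (h : Within p s T Φ) (h' : ∀ s', Unchanged p s s' → Φ s' → Within q s' T' Ψ) :
    Within (.seq p q) s (T + T') Ψ := by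
  obtain ⟨s₁, t₁, h1, h2, h3⟩ := h
  obtain ⟨s₂, t₂, h4, h5, h6⟩ := h' s₁ (h1 fun _ => 0).unchanged h3
  exact ⟨s₂, t₁ + t₂, fun ω => .seq (h1 ω) (h4 ω), by omega, h6⟩

theorem Within.ite {c : Test} {p q : Prog} {s : RAMState} {T : ℕ} {Φ : RAMState → Prop}
    (hp : c.holds s → Within p s T Φ) (hq : ¬ c.holds s → Within q s T Φ) :
    Within (.ite c p q) s (T + 1) Φ := by
  by_cases hc : c.holds s
  · obtain ⟨s₁, t₁, h1, h2, h3⟩ := hp hc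
    exact ⟨s₁, t₁ + 1, fun ω => .ite_pos hc (h1 ω), by omega, h3⟩
  · obtain ⟨s₁, t₁, h1, h2, h3⟩ := hq hc
    exact ⟨s₁, t₁ + 1, fun ω => .ite_neg hc (h1 ω), by omega, h3⟩

/-- A loop, with an invariant that is indexed by a bound for the number of rounds to come. -/
theorem Within.loop {c : Test} {p : Prog} {T : ℕ} (I : ℕ → RAMState → Prop) {s₀ : RAMState}
    (h : ∀ v s, I v s → Unchanged p s₀ s → c.holds s →
      Within p s T fun s' => ∃ v' < v, I v' s') {v : ℕ} (h₀ : I v s₀) :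
    Within (.loop c p) s₀ (v * (T + 1) + 1) fun s' => (∃ v, I v s') ∧ ¬ c.holds s' := by
  suffices H : ∀ v s, I v s → Unchanged p s₀ s → Within (.loop c p) s (v * (T + 1) + 1)
      fun s' => (∃ v, I v s') ∧ ¬ c.holds s' from H v s₀ h₀ (Unchanged.refl _ _)
  intro v
  induction v using Nat.strong_induction_on with
  | _ v ih =>
    intro s hs hu
    by_cases hc : c.holds s
    · obtain ⟨s₁, t₁, h1, h2, v', hv', h3⟩ := h v s hs hu hc
      obtain ⟨s₂, t₂, h4, h5, h6⟩ := ih v' hv' s₁ h3 (hu.trans (h1 fun _ => 0).unchanged)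
      refine ⟨s₂, t₁ + t₂ + 1, fun ω => .loop_step hc (h1 ω) (h4 ω), ?_, h6⟩
      have : (v' + 1) * (T + 1) ≤ v * (T + 1) := Nat.mul_le_mul_right _ hv'
      rw [add_mul] at this
      omega
    · exact ⟨s, 1, fun ω => Exec.loop_stop hc, by omega, ⟨v, hs⟩, hc⟩

/-- A straight-line program. -/
def block (i : Instr) : List Instr → Prog
  | [] => .basic i
  | j :: l => .seq (.basic i) (block j l)

/-- Effect of an instruction that does not draw a random number. -/
noncomputable def Instr.step (s : RAMState) (i : Instr) : RAMState := i.apply (fun _ => 0) s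

theorem Within.basic {i : Instr} (hi : ∀ ω s, i.apply ω s = i.step s) (s : RAMState) :
    Within (.basic i) s 1 fun s' => s' = i.step s :=
  ⟨_, 1, fun ω => hi ω s ▸ .basic i s, le_rfl, rfl⟩

theorem Within.block {i : Instr} {l : List Instr}
    (hl : ∀ j ∈ i :: l, ∀ ω s, j.apply ω s = j.step s) (s : RAMState) :
    Within (block i l) s (l.length + 1) fun s' => s' = (i :: l).foldl Instr.step s := by
  induction l generalizing i s with
  | nil => exact Within.basic (hl i (by simp)) s
  | cons j l ih =>
    obtain ⟨s', t, h1, h2, h3⟩ := ih (i := j) (fun j' h' => hl j' (List.mem_cons_of_mem _ h'))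
      (i.step s)
    refine ⟨s', 1 + t, fun ω => .seq (hl i (by simp) ω s ▸ .basic i s) (h1 ω), ?_, h3⟩
    simp only [List.length_cons]
    omega

/-! ### Subdividing a family of segments into short pieces -/

/-- Sum over what is left of a family `P` of `n` segments when all segments before the `i`-th have
been treated and `cur` is left of the `i`-th. -/
def restSum {M : Type*} [AddCommMonoid M] (f : Seg → M) (P : ℕ → Seg) (n i : ℕ) (cur : Seg) : M :=
  if i < n then f cur + ∑ j ∈ Finset.Ico (i + 1) n, f (P j) else 0

theorem restSum_zero {M : Type*} [AddCommMonoid M] (f : Seg → M) (P : ℕ → Seg) (n : ℕ) :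
    restSum f P n 0 (P 0) = ∑ j ∈ Finset.range n, f (P j) := by
  rw [restSum]
  split_ifs with h
  · rw [Finset.range_eq_Ico, Finset.sum_eq_sum_Ico_succ_bot h]
  · rw [Nat.eq_zero_of_not_pos h]
    simp

theorem restSum_succ {M : Type*} [AddCommMonoid M] (f : Seg → M) {P : ℕ → Seg} {n i : ℕ}
    (hi : i < n) (cur : Seg) {cur' : Seg} (h : i + 1 < n → cur' = P (i + 1)) :
    restSum f P n i cur = f cur + restSum f P n (i + 1) cur' := by
  rw [restSum, if_pos hi, restSum]
  split_ifs with h'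
  · rw [Finset.sum_eq_sum_Ico_succ_bot h', h h']
  · rw [Finset.Ico_eq_empty (by omega), Finset.sum_empty]

/-- The first `k` entries of `D`, with lengths `W`, are the pieces of length at most `g` into which
the family `P` has been cut before what is left (`cur` of the `i`-th segment, and all later
segments); `v` bounds the number of pieces to come. -/
structure Subdivision (P : ℕ → Seg) (n : ℕ) (g : ℝ) (V v k i : ℕ) (cur : Seg) (rem : ℝ)
    (D : ℕ → Seg) (W : ℕ → ℝ) : Prop where
  le : i ≤ n
  rem_eq : i < n → rem = cur.len ∧ 0 < cur.len
  piece : ∀ e < k, W e = (D e).len ∧ 0 < (D e).len ∧ (D e).len ≤ g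
  meas_eq : ∑ e ∈ Finset.range k, (D e).meas + restSum Seg.meas P n i cur =
    ∑ j ∈ Finset.range n, (P j).meas
  index_le : i ≤ k
  potential_le : n - i + ⌈restSum Seg.len P n i cur / g⌉₊ ≤ v
  count_le : k + v ≤ V

section

variable {P : ℕ → Seg} {n : ℕ} {g : ℝ} {V v k i : ℕ} {cur : Seg} {rem : ℝ} {D : ℕ → Seg}
  {W : ℕ → ℝ}

theorem Subdivision.start (hn : 0 < n) (hP : 0 < (P 0).len)
    (hV : n + ⌈(∑ j ∈ Finset.range n, (P j).len) / g⌉₊ ≤ V) :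
    Subdivision P n g V V 0 0 (P 0) (P 0).len D W where
  le := hn.le
  rem_eq _ := ⟨rfl, hP⟩
  piece e he := absurd he (Nat.not_lt_zero e)
  meas_eq := by rw [restSum_zero]; simp
  index_le := le_rfl
  potential_le := by rwa [restSum_zero]
  count_le := by simp

/-- Cutting off length `g` lowers the ceiling in the potential by exactly one. The strict inequality
`g < rem` keeps the rest non-degenerate, so that all weights given to `A` are positive. -/
theorem Subdivision.cut (h : Subdivision P n g V v k i cur rem D W) (hg : 0 < g) (hi : i < n)
    (hrem : g < rem) {D' : ℕ → Seg} {W' : ℕ → ℝ} (hD : ∀ e < k, D' e = D e)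
    (hW : ∀ e < k, W' e = W e) (hDk : D' k = cur.part 0 (g / rem)) (hWk : W' k = g) :
    ∃ v' < v, Subdivision P n g V v' (k + 1) i (cur.part (g / rem) 1) (rem - g) D' W' := by
  obtain ⟨h1, h2, h3, h4, h5, h6, h7⟩ := h
  obtain ⟨rfl, hpos⟩ := h2 hi
  have t0 : 0 ≤ g / cur.len := by positivity
  have t1 : g / cur.len ≤ 1 := (div_le_one hpos).2 hrem.le
  have e1 : (cur.part 0 (g / cur.len)).len = g := by
    rw [cur.part_len t0, sub_zero, div_mul_cancel₀ _ hpos.ne']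
  have e2 : (cur.part (g / cur.len) 1).len = cur.len - g := by
    rw [cur.part_len t1, sub_mul, div_mul_cancel₀ _ hpos.ne', one_mul]
  have hl : restSum Seg.len P n i (cur.part (g / cur.len) 1) / g =
      restSum Seg.len P n i cur / g - 1 := by
    rw [restSum, restSum, if_pos hi, if_pos hi, e2]
    field_simp
    ring
  have h0 : 0 < restSum Seg.len P n i cur := by
    rw [restSum, if_pos hi]
    exact add_pos_of_pos_of_nonneg hpos (Finset.sum_nonneg fun j _ => (P j).len_nonneg)
  have hceil : 0 < ⌈restSum Seg.len P n i cur / g⌉₊ := Nat.ceil_pos.2 (by positivity)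
  refine ⟨v - 1, by omega, h1, fun _ => ⟨e2.symm, by rw [e2]; linarith⟩, ?_, ?_, by omega, ?_,
    by omega⟩
  · intro e he
    rcases Nat.lt_succ_iff_lt_or_eq.1 he with he | rfl
    · rw [hD e he, hW e he]; exact h3 e he
    · rw [hDk, hWk, e1]; exact ⟨rfl, hg, le_rfl⟩
  · rw [Finset.sum_range_succ, hDk,
      Finset.sum_congr rfl fun e he => by rw [hD e (Finset.mem_range.1 he)], ← h4, restSum,
      restSum, if_pos hi, if_pos hi, ← cur.meas_split t0 t1]
    simp only [add_assoc]
  · rw [hl, Nat.ceil_sub_one]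
    omega

/-- The index of the segment grows and the remaining length does not, so the potential drops. After
the last segment `cur'` is unconstrained, because the program then reads an entry that does not
belong to the family. -/
theorem Subdivision.finish (h : Subdivision P n g V v k i cur rem D W) (hi : i < n) (hg : 0 < g)
    (hP : ∀ j < n, 0 < (P j).len) (hrem : rem ≤ g) {D' : ℕ → Seg} {W' : ℕ → ℝ} {cur' : Seg}
    {rem' : ℝ} (hD : ∀ e < k, D' e = D e) (hW : ∀ e < k, W' e = W e) (hDk : D' k = cur)
    (hWk : W' k = rem) (hcur : i + 1 < n → cur' = P (i + 1)) (hrem' : rem' = cur'.len) :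
    ∃ v' < v, Subdivision P n g V v' (k + 1) (i + 1) cur' rem' D' W' := by
  obtain ⟨h1, h2, h3, h4, h5, h6, h7⟩ := h
  obtain ⟨rfl, hpos⟩ := h2 hi
  have hle : ⌈restSum Seg.len P n (i + 1) cur' / g⌉₊ ≤ ⌈restSum Seg.len P n i cur / g⌉₊ := by
    refine Nat.ceil_le_ceil (div_le_div_of_nonneg_right ?_ hg.le)
    rw [restSum_succ Seg.len hi cur hcur]
    linarith
  refine ⟨v - 1, by omega, hi, fun h => ⟨hrem', by rw [hcur h]; exact hP _ h⟩, ?_, ?_, by omega,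
    by omega, by omega⟩
  · intro e he
    rcases Nat.lt_succ_iff_lt_or_eq.1 he with he | rfl
    · rw [hD e he, hW e he]; exact h3 e he
    · rw [hDk, hWk]; exact ⟨rfl, hpos, hrem⟩
  · rw [Finset.sum_range_succ, hDk,
      Finset.sum_congr rfl fun e he => by rw [hD e (Finset.mem_range.1 he)], ← h4,
      restSum_succ Seg.meas hi cur hcur, add_assoc]

end

/-! #### The program -/

/-- The segment whose end points have their coordinates in the registers `r, …, r + 3`. -/
noncomputable def registerSeg (s : RAMState) (r : ℕ) : Seg where
  a := !₂[s.rreg r, s.rreg (r + 1)]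
  b := !₂[s.rreg (r + 2), s.rreg (r + 3)]

theorem Seg.len_mk (x y z w : ℝ) :
    (Seg.mk !₂[x, y] !₂[z, w]).len = √((x - z) * (x - z) + (y - w) * (y - w)) := by
  rw [Seg.len, EuclideanSpace.dist_eq]
  simp [Real.dist_eq, sq]

theorem Seg.part_mk_left (x y z w t : ℝ) : (Seg.mk !₂[x, y] !₂[z, w]).part 0 t =
    ⟨!₂[x, y], !₂[x + t * (z - x), y + t * (w - y)]⟩ := by
  simp only [Seg.part, Seg.mk.injEq]
  constructor <;> ext i <;> fin_cases i <;> simp [AffineMap.lineMap_apply_module'] <;> ring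

theorem Seg.part_mk_right (x y z w t : ℝ) : (Seg.mk !₂[x, y] !₂[z, w]).part t 1 =
    ⟨!₂[x + t * (z - x), y + t * (w - y)], !₂[z, w]⟩ := by
  simp only [Seg.part, Seg.mk.injEq]
  constructor <;> ext i <;> fin_cases i <;> simp [AffineMap.lineMap_apply_module'] <;> ring

/-- Load the segment with the number in register `b + 30` from the arrays `c, …, c + 3` and compute
its length. -/
def loadSegment (b c : ℕ) : List Instr :=
  [.rload (b + 30) c (b + 30), .rload (b + 31) (c + 1) (b + 30), .rload (b + 32) (c + 2) (b + 30),
    .rload (b + 33) (c + 3) (b + 30), .rsub (b + 35) (b + 30) (b + 32),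
    .rmul (b + 35) (b + 35) (b + 35), .rsub (b + 36) (b + 31) (b + 33),
    .rmul (b + 36) (b + 36) (b + 36), .radd (b + 35) (b + 35) (b + 36), .rsqrt (b + 34) (b + 35)]

/-- Cut a piece of standard length off the current segment. -/
def cutPiece (b kr d : ℕ) : Prog :=
  block (.rdiv (b + 35) (b + 20) (b + 34))
    [.rsub (b + 36) (b + 32) (b + 30), .rmul (b + 36) (b + 35) (b + 36),
      .radd (b + 37) (b + 30) (b + 36), .rsub (b + 36) (b + 33) (b + 31),
      .rmul (b + 36) (b + 35) (b + 36), .radd (b + 38) (b + 31) (b + 36),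
      .rstore d kr (b + 30), .rstore (d + 1) kr (b + 31), .rstore (d + 2) kr (b + 37),
      .rstore (d + 3) kr (b + 38), .rstore (d + 4) kr (b + 20), .radd (b + 30) (b + 37) (b + 29),
      .radd (b + 31) (b + 38) (b + 29), .rsub (b + 34) (b + 34) (b + 20), .nadd kr kr (b + 28)]

/-- The rest of the current segment is the last piece; go on to the next segment. -/
def finishPiece (b c kr d : ℕ) : Prog :=
  block (.rstore d kr (b + 30))
    ([.rstore (d + 1) kr (b + 31), .rstore (d + 2) kr (b + 32), .rstore (d + 3) kr (b + 33),
      .rstore (d + 4) kr (b + 34), .nadd kr kr (b + 28), .nadd (b + 30) (b + 30) (b + 28)] ++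
      loadSegment b c)

/-- Subdivide the segments in the arrays `c, …, c + 3` (their number is in register `nr`).
The pieces and their lengths go to the arrays `d, …, d + 4`, their number to register `kr`. -/
def subdivide (b c nr kr d : ℕ) : Prog :=
  .seq (block (.nconst (b + 30) 0) (.nconst kr 0 :: loadSegment b c))
    (.loop (.nlt (b + 30) nr)
      (.ite (.rlt (b + 20) (b + 34)) (cutPiece b kr d) (finishPiece b c kr d)))

/-! ### Effect and running time of the subdivision -/

theorem within_cutPiece {b kr d : ℕ} (hkr : kr < b + 28) (s : RAMState)
    (h1 : s.nreg (b + 28) = 1) (h0 : s.rreg (b + 29) = 0) :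
    Within (cutPiece b kr d) s 16 fun s' =>
      s'.nreg kr = s.nreg kr + 1 ∧ s'.nreg (b + 30) = s.nreg (b + 30) ∧
      registerSeg s' (b + 30) = (registerSeg s (b + 30)).part (s.rreg (b + 20) / s.rreg (b + 34)) 1 ∧
      s'.rreg (b + 34) = s.rreg (b + 34) - s.rreg (b + 20) ∧
      segmentAt s' d (s.nreg kr) =
        (registerSeg s (b + 30)).part 0 (s.rreg (b + 20) / s.rreg (b + 34)) ∧
      s'.rarr (d + 4) (s.nreg kr) = s.rreg (b + 20) ∧
      ∀ e < s.nreg kr, segmentAt s' d e = segmentAt s d e ∧ s'.rarr (d + 4) e = s.rarr (d + 4) e := by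
  refine (Within.block (by simp [Instr.step, Instr.apply]) s).mono (by simp) ?_
  rintro s' - rfl
  have a1 : b + 30 ≠ kr := by omega
  simp +contextual [Instr.step, Instr.apply, registerSeg, Seg.part_mk_left, Seg.part_mk_right,
    segmentAt, h1, h0, a1, Nat.ne_of_lt]

theorem within_finishPiece {b c kr d : ℕ} (hkr : kr < b + 28) (hc : c + 4 ≤ d) (s : RAMState)
    (h1 : s.nreg (b + 28) = 1) :
    Within (finishPiece b c kr d) s 17 fun s' =>
      s'.nreg kr = s.nreg kr + 1 ∧ s'.nreg (b + 30) = s.nreg (b + 30) + 1 ∧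
      registerSeg s' (b + 30) = segmentAt s c (s.nreg (b + 30) + 1) ∧
      s'.rreg (b + 34) = (registerSeg s' (b + 30)).len ∧
      segmentAt s' d (s.nreg kr) = registerSeg s (b + 30) ∧
      s'.rarr (d + 4) (s.nreg kr) = s.rreg (b + 34) ∧
      ∀ e < s.nreg kr, segmentAt s' d e = segmentAt s d e ∧ s'.rarr (d + 4) e = s.rarr (d + 4) e := by
  refine (Within.block (by simp [loadSegment, Instr.step, Instr.apply]) s).mono
    (by simp [loadSegment]) ?_
  rintro s' - rfl
  have a1 : b + 30 ≠ kr := by omega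
  have a2 : kr ≠ b + 30 := by omega
  have a3 : b + 28 ≠ kr := by omega
  have a4 : ∀ i < 4, ∀ j < 5, c + i ≠ d + j := by intros; omega
  have a5 := a4 0 (by norm_num) 0 (by norm_num)
  have a6 : ∀ j < 5, c ≠ d + j := by intros; omega
  have a7 : ∀ i < 4, c + i ≠ d := by intros; omega
  simp only [add_zero] at a5
  simp +contextual [loadSegment, Instr.step, Instr.apply, registerSeg, Seg.len_mk,
    segmentAt, h1, a1, a2, a3, a4, a5, a6, a7, Nat.ne_of_lt]

theorem within_startSubdivide {b c kr : ℕ} (hkr : kr < b + 28) (s : RAMState) :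
    Within (block (.nconst (b + 30) 0) (.nconst kr 0 :: loadSegment b c)) s 12 fun s' =>
      s'.nreg kr = 0 ∧ s'.nreg (b + 30) = 0 ∧ registerSeg s' (b + 30) = segmentAt s c 0 ∧
      s'.rreg (b + 34) = (registerSeg s' (b + 30)).len := by
  refine (Within.block (by simp [loadSegment, Instr.step, Instr.apply]) s).mono
    (by simp [loadSegment]) ?_
  rintro s' - rfl
  have a1 : b + 30 ≠ kr := by omega
  simp [loadSegment, Instr.step, Instr.apply, registerSeg, Seg.len_mk, segmentAt, a1]

theorem segmentAt_congr {s s' : RAMState} {c : ℕ} (h : ∀ A, c ≤ A → A < c + 4 → s'.rarr A = s.rarr A)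
    (e : ℕ) : segmentAt s' c e = segmentAt s c e := by
  simp [segmentAt, h c (by omega) (by omega), h (c + 1) (by omega) (by omega),
    h (c + 2) (by omega) (by omega), h (c + 3) (by omega) (by omega)]

/-- The potential `n - i + ⌈rest / g⌉` bounds both the rounds to come and the pieces still to be
written. As each round writes one piece, at most `V` pieces arise; as each segment ends with a piece
of its own, there are at least as many pieces as segments. -/
theorem within_subdivide {b c nr kr d : ℕ} (hc : c + 4 ≤ b + 20) (hnr : nr < b + 20)
    (hkr : b + 20 ≤ kr) (hkr' : kr < b + 28) (hd : b + 20 ≤ d) {s : RAMState}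
    (h1 : s.nreg (b + 28) = 1) (h0 : s.rreg (b + 29) = 0) (hg : 0 < s.rreg (b + 20))
    (hn : 0 < s.nreg nr) (hP : ∀ j < s.nreg nr, 0 < (segmentAt s c j).len) {V : ℕ}
    (hV : s.nreg nr + ⌈(∑ j ∈ Finset.range (s.nreg nr), (segmentAt s c j).len) /
      s.rreg (b + 20)⌉₊ ≤ V) :
    Within (subdivide b c nr kr d) s (12 + (V * 19 + 1)) fun s' =>
      s.nreg nr ≤ s'.nreg kr ∧ s'.nreg kr ≤ V ∧
      (∀ e < s'.nreg kr, s'.rarr (d + 4) e = (segmentAt s' d e).len ∧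
        0 < (segmentAt s' d e).len ∧ (segmentAt s' d e).len ≤ s.rreg (b + 20)) ∧
      ∑ e ∈ Finset.range (s'.nreg kr), (segmentAt s' d e).meas =
        ∑ j ∈ Finset.range (s.nreg nr), (segmentAt s c j).meas := by
  refine Within.seq (within_startSubdivide hkr' s) ?_
  rintro s₀ hu₀ ⟨e1, e2, e3, e4⟩
  have u1 : s₀.nreg (b + 28) = 1 := by
    rw [hu₀.nreg _ (by simp [loadSegment, block, Prog.Has, Instr.WritesN]; omega), h1]
  have u2 : s₀.rreg (b + 29) = 0 := by
    rw [hu₀.rreg _ (by simp [loadSegment, block, Prog.Has, Instr.WritesR]), h0]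
  have u3 : s₀.rreg (b + 20) = s.rreg (b + 20) := by
    rw [hu₀.rreg _ (by simp [loadSegment, block, Prog.Has, Instr.WritesR])]
  have u4 : s₀.nreg nr = s.nreg nr := by
    rw [hu₀.nreg _ (by simp [loadSegment, block, Prog.Has, Instr.WritesN]; omega)]
  have u5 : ∀ j, segmentAt s₀ c j = segmentAt s c j := segmentAt_congr fun A _ _ => by
    rw [hu₀.rarr _ (by simp [loadSegment, block, Prog.Has, Instr.WritesRArr])]
  set g := s.rreg (b + 20)
  set n := s.nreg nr
  set P := fun j => segmentAt s c j
  -- At most 17 steps for the longer branch and one for the test between the branches; the loop test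
  -- makes 19 per round.
  refine (Within.loop (T := 18) (v := V) (fun v s' => Subdivision P n g V v (s'.nreg kr)
    (s'.nreg (b + 30)) (registerSeg s' (b + 30)) (s'.rreg (b + 34)) (segmentAt s' d)
    (s'.rarr (d + 4))) ?_ ?_).mono le_rfl ?_
  · intro v s' hI hu hlt
    have w1 : s'.nreg (b + 28) = 1 := by
      rw [hu.nreg _ (by
        simp [cutPiece, finishPiece, loadSegment, block, Prog.Has, Instr.WritesN]; omega), u1]
    have w2 : s'.rreg (b + 29) = 0 := by
      rw [hu.rreg _ (by
        simp [cutPiece, finishPiece, loadSegment, block, Prog.Has, Instr.WritesR]), u2]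
    have w3 : s'.rreg (b + 20) = g := by
      rw [hu.rreg _ (by
        simp [cutPiece, finishPiece, loadSegment, block, Prog.Has, Instr.WritesR]), u3]
    have w4 : s'.nreg nr = n := by
      rw [hu.nreg _ (by
        simp [cutPiece, finishPiece, loadSegment, block, Prog.Has, Instr.WritesN]; omega), u4]
    have w5 : ∀ j, segmentAt s' c j = P j := fun j => by
      rw [segmentAt_congr (fun A _ _ => hu.rarr A (by
        simp [cutPiece, finishPiece, loadSegment, block, Prog.Has, Instr.WritesRArr]; omega)), u5]
    have hi : s'.nreg (b + 30) < n := by simpa [Test.holds, w4] using hlt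
    refine Within.ite (fun ht => ?_) (fun ht => ?_)
    · refine (within_cutPiece hkr' s' w1 w2).mono (by norm_num) ?_
      rintro s'' - ⟨f1, f2, f3, f4, f5, f6, f7⟩
      rw [w3] at f3 f4 f5 f6
      rw [f1, f2, f3, f4]
      exact hI.cut hg hi (by simpa [Test.holds, w3] using ht) (fun e he => (f7 e he).1)
        (fun e he => (f7 e he).2) f5 f6
    · refine (within_finishPiece hkr' (by omega) s' w1).mono (by norm_num) ?_
      rintro s'' - ⟨f1, f2, f3, f4, f5, f6, f7⟩
      rw [f1, f2]
      exact hI.finish hi hg hP (by simpa [Test.holds, w3] using ht) (fun e he => (f7 e he).1)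
        (fun e he => (f7 e he).2) f5 f6 (fun _ => by rw [f3, w5]) f4
  · rw [e4, e1, e2, e3]
    exact Subdivision.start hn (hP 0 hn) hV
  · rintro s' hu ⟨⟨v, hI⟩, hlt⟩
    have w4 : s'.nreg nr = n := by
      rw [hu.nreg _ (by
        simp [cutPiece, finishPiece, loadSegment, block, Prog.Has, Instr.WritesN]; omega), u4]
    have hi : s'.nreg (b + 30) = n :=
      le_antisymm hI.le (by simpa [Test.holds, w4] using hlt)
    refine ⟨hi ▸ hI.index_le, by have := hI.count_le; omega, hI.piece, ?_⟩
    have := hI.meas_eq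
    rwa [restSum, if_neg (by omega), add_zero] at this

/-! ### The program that reduces segments to points -/

/-- Set the first entries of the arrays `0, …, 7` to zero; their number is in register `b + 27`. -/
def clearInputs (b : ℕ) : Prog :=
  .seq (.basic (.nconst (b + 30) 0)) (.loop (.nlt (b + 30) (b + 27))
    (block (.rstore 0 (b + 30) (b + 29)) [.rstore 1 (b + 30) (b + 29),
      .rstore 2 (b + 30) (b + 29), .rstore 3 (b + 30) (b + 29), .rstore 4 (b + 30) (b + 29),
      .rstore 5 (b + 30) (b + 29), .rstore 6 (b + 30) (b + 29), .rstore 7 (b + 30) (b + 29),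
      .nadd (b + 30) (b + 30) (b + 28)]))

/-- Copy the first end points and the lengths of the pieces in the arrays `c, …, c + 4` to the
arrays `d, d + 1, d + 2`. -/
def copyPoints (b c d kr : ℕ) : Prog :=
  .seq (.basic (.nconst (b + 30) 0)) (.loop (.nlt (b + 30) kr)
    (block (.rload (b + 30) c (b + 30)) [.rstore d (b + 30) (b + 30),
      .rload (b + 30) (c + 1) (b + 30), .rstore (d + 1) (b + 30) (b + 30),
      .rload (b + 30) (c + 4) (b + 30), .rstore (d + 2) (b + 30) (b + 30),
      .nadd (b + 30) (b + 30) (b + 28)]))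

/-- Replace the points of a plan by the pieces on which they were chosen. -/
def copyOutput (b : ℕ) : Prog :=
  .seq (.basic (.nconst (b + 30) 0)) (.loop (.nlt (b + 30) 0)
    (block (.nload (b + 31) 0 (b + 30)) [.nload (b + 32) 1 (b + 30),
      .rload (b + 30) (b + 20) (b + 31), .rstore 8 (b + 30) (b + 30),
      .rload (b + 30) (b + 21) (b + 31), .rstore 9 (b + 30) (b + 30),
      .rload (b + 30) (b + 22) (b + 31), .rstore 10 (b + 30) (b + 30),
      .rload (b + 30) (b + 23) (b + 31), .rstore 11 (b + 30) (b + 30),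
      .rload (b + 30) (b + 25) (b + 32), .rstore 12 (b + 30) (b + 30),
      .rload (b + 30) (b + 26) (b + 32), .rstore 13 (b + 30) (b + 30),
      .rload (b + 30) (b + 27) (b + 32), .rstore 14 (b + 30) (b + 30),
      .rload (b + 30) (b + 28) (b + 32), .rstore 15 (b + 30) (b + 30),
      .rload (b + 30) 6 (b + 30), .rstore 16 (b + 30) (b + 30),
      .nadd (b + 30) (b + 30) (b + 28)]))

/-- Compute the length `δ / ((1 + δ) n m)` of the pieces. -/
def setUp (b : ℕ) : Prog :=
  block (.nconst (b + 28) 1) [.nadd (b + 27) 0 1, .rcast (b + 21) 0, .rcast (b + 22) 1,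
    .rmul (b + 21) (b + 21) (b + 22), .rcast (b + 22) (b + 28), .radd (b + 22) (b + 22) 0,
    .rmul (b + 21) (b + 22) (b + 21), .rdiv (b + 20) 0 (b + 21)]

/-- Turn two families of segments into two families of weighted points. -/
def prepare (b : ℕ) : Prog :=
  .seq (setUp b) (.seq (subdivide b 0 0 (b + 24) (b + 20)) (.seq (subdivide b 4 1 (b + 25) (b + 25))
    (.seq (clearInputs b) (.seq (copyPoints b (b + 20) 0 (b + 24))
      (.seq (copyPoints b (b + 25) 3 (b + 25))
        (block (.nadd 0 (b + 24) (b + 29)) [.nadd 1 (b + 25) (b + 29)]))))))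

/-- The program for segments that uses the program `A` for points. -/
def segmentProgram (A : Prog) : Prog :=
  .seq (prepare A.bound) (.seq A (copyOutput A.bound))

/-! ### Effect and running time of clearing and copying -/

theorem within_nconst (d c : ℕ) (s : RAMState) :
    Within (.basic (.nconst d c)) s 1 fun s' => s' = s.setN d c :=
  Within.basic (fun _ _ => rfl) s

/-- The end points of the segments occupy arrays that `A` reads, and `A` expects zeros beyond its
points, so they are erased once the pieces are stored elsewhere. -/
theorem within_clearInputs {b : ℕ} {s : RAMState} (h1 : s.nreg (b + 28) = 1)
    (h0 : s.rreg (b + 29) = 0) :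
    Within (clearInputs b) s (1 + (s.nreg (b + 27) * 10 + 1)) fun s' =>
      ∀ A < 8, ∀ e, s'.rarr A e = if e < s.nreg (b + 27) then 0 else s.rarr A e := by
  refine Within.seq (within_nconst _ _ s) ?_
  rintro _ - rfl
  refine (Within.loop (T := 9) (v := s.nreg (b + 27)) (fun v s' =>
    s'.nreg (b + 30) + v = s.nreg (b + 27) ∧ ∀ A < 8, ∀ e, s'.rarr A e =
      if e < s'.nreg (b + 30) then 0 else s.rarr A e) ?_ ?_).mono le_rfl ?_
  · rintro v s' ⟨hv, hI⟩ hu hlt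
    have w1 : s'.nreg (b + 28) = 1 := by
      rw [hu.nreg _ (by simp [block, Prog.Has, Instr.WritesN])]; simpa using h1
    have w2 : s'.rreg (b + 29) = 0 := by
      rw [hu.rreg _ (by simp [block, Prog.Has, Instr.WritesR])]; simpa using h0
    have w3 : s'.nreg (b + 27) = s.nreg (b + 27) := by
      rw [hu.nreg _ (by simp [block, Prog.Has, Instr.WritesN])]; simp
    simp only [Test.holds, w3] at hlt
    refine (Within.block (by simp [Instr.step, Instr.apply]) s').mono (by simp) ?_
    rintro s'' - rfl
    refine ⟨v - 1, by omega, ?_, ?_⟩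
    · simp [Instr.step, Instr.apply, w1]
      omega
    · intro A hA e
      have hA' := hI A hA e
      interval_cases A <;>
      · simp only [List.foldl, Instr.step, Instr.apply]
        simp [w1, w2, hA']
        grind
  · simp
  · rintro s' hu ⟨⟨v, hv, hI⟩, hlt⟩
    have w3 : s'.nreg (b + 27) = s.nreg (b + 27) := by
      rw [hu.nreg _ (by simp [block, Prog.Has, Instr.WritesN])]; simp
    simp only [Test.holds, w3] at hlt
    have : s'.nreg (b + 30) = s.nreg (b + 27) := by omega
    rwa [this] at hI

theorem within_copyPoints {b c d kr : ℕ} (hd : d + 3 ≤ c) (hkr : kr < b + 28) {s : RAMState}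
    (h1 : s.nreg (b + 28) = 1) :
    Within (copyPoints b c d kr) s (1 + (s.nreg kr * 8 + 1)) fun s' =>
      (∀ e, s'.rarr d e = if e < s.nreg kr then s.rarr c e else s.rarr d e) ∧
      (∀ e, s'.rarr (d + 1) e = if e < s.nreg kr then s.rarr (c + 1) e else s.rarr (d + 1) e) ∧
      ∀ e, s'.rarr (d + 2) e = if e < s.nreg kr then s.rarr (c + 4) e else s.rarr (d + 2) e := by
  refine Within.seq (within_nconst _ _ s) ?_
  rintro _ - rfl
  refine (Within.loop (T := 7) (v := s.nreg kr) (fun v s' =>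
    s'.nreg (b + 30) + v = s.nreg kr ∧
      (∀ e, s'.rarr d e = if e < s'.nreg (b + 30) then s.rarr c e else s.rarr d e) ∧
      (∀ e, s'.rarr (d + 1) e =
        if e < s'.nreg (b + 30) then s.rarr (c + 1) e else s.rarr (d + 1) e) ∧
      ∀ e, s'.rarr (d + 2) e =
        if e < s'.nreg (b + 30) then s.rarr (c + 4) e else s.rarr (d + 2) e) ?_ ?_).mono le_rfl ?_
  · rintro v s' ⟨hv, hI0, hI1, hI2⟩ hu hlt
    have w1 : s'.nreg (b + 28) = 1 := by
      rw [hu.nreg _ (by simp [block, Prog.Has, Instr.WritesN])]; simpa using h1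
    have w2 : ∀ j, s'.rarr (c + j) = s.rarr (c + j) := fun j => by
      rw [hu.rarr _ (by simp [block, Prog.Has, Instr.WritesRArr]; omega)]; simp
    have w20 := w2 0
    rw [add_zero] at w20
    have w3 : s'.nreg kr = s.nreg kr := by
      rw [hu.nreg _ (by simp [block, Prog.Has, Instr.WritesN]; omega)]; simp; omega
    simp only [Test.holds, w3] at hlt
    refine (Within.block (by simp [Instr.step, Instr.apply]) s').mono (by simp) ?_
    rintro s'' - rfl
    have n1 : ∀ j, c + j ≠ d := by intros; omega
    have n2 : ∀ j, c + j ≠ d + 1 := by intros; omega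
    refine ⟨v - 1, by omega, ?_, fun e => ?_, fun e => ?_, fun e => ?_⟩
    · simp [Instr.step, Instr.apply, w1]
      omega
    · have := hI0 e
      simp only [List.foldl, Instr.step, Instr.apply]
      simp [w1, w2, w20, this]
      grind
    · have := hI1 e
      simp only [List.foldl, Instr.step, Instr.apply]
      simp [w1, w2, n1, n2, this]
      grind
    · have := hI2 e
      simp only [List.foldl, Instr.step, Instr.apply]
      simp [w1, w2, n1, n2, this]
      grind
  · simp
  · rintro s' hu ⟨⟨v, hv, hI⟩, hlt⟩
    have w3 : s'.nreg kr = s.nreg kr := by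
      rw [hu.nreg _ (by simp [block, Prog.Has, Instr.WritesN]; omega)]; simp; omega
    simp only [Test.holds, w3] at hlt
    have : s'.nreg (b + 30) = s.nreg kr := by omega
    rwa [this] at hI

theorem within_copyOutput {b : ℕ} {s : RAMState} (h1 : s.nreg (b + 28) = 1) :
    Within (copyOutput b) s (1 + (s.nreg 0 * 22 + 1)) fun s' => ∀ e < s.nreg 0,
      s'.rarr 16 e = s.rarr 6 e ∧ segmentAt s' 8 e = segmentAt s (b + 20) (s.narr 0 e) ∧
      segmentAt s' 12 e = segmentAt s (b + 25) (s.narr 1 e) := by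
  refine Within.seq (within_nconst _ _ s) ?_
  rintro _ - rfl
  refine (Within.loop (T := 21) (v := s.nreg 0) (fun v s' =>
    s'.nreg (b + 30) + v = s.nreg 0 ∧ ∀ e < s'.nreg (b + 30),
      s'.rarr 16 e = s.rarr 6 e ∧ segmentAt s' 8 e = segmentAt s (b + 20) (s.narr 0 e) ∧
      segmentAt s' 12 e = segmentAt s (b + 25) (s.narr 1 e)) ?_ ?_).mono le_rfl ?_
  · rintro v s' ⟨hv, hI⟩ hu hlt
    have w1 : s'.nreg (b + 28) = 1 := by
      rw [hu.nreg _ (by simp [block, Prog.Has, Instr.WritesN])]; simpa using h1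
    have w2 : ∀ j, 20 ≤ j → s'.rarr (b + j) = s.rarr (b + j) := fun j hj => by
      rw [hu.rarr _ (by simp [block, Prog.Has, Instr.WritesRArr]; omega)]; simp
    have w4 : s'.rarr 6 = s.rarr 6 := by
      rw [hu.rarr _ (by simp [block, Prog.Has, Instr.WritesRArr])]; simp
    have w5 : s'.narr = s.narr := by
      ext A : 1
      rw [hu.narr _ (by simp [block, Prog.Has, Instr.WritesNArr])]; simp
    have w3 : s'.nreg 0 = s.nreg 0 := by
      rw [hu.nreg _ (by simp [block, Prog.Has, Instr.WritesN])]; simp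
    simp only [Test.holds, w3] at hlt
    refine (Within.block (by simp [Instr.step, Instr.apply]) s').mono (by simp) ?_
    rintro s'' - rfl
    refine ⟨v - 1, by omega, ?_, fun e he => ?_⟩
    · simp [Instr.step, Instr.apply, w1]
      omega
    · have he' : e < s'.nreg (b + 30) + 1 := by
        simpa [Instr.step, Instr.apply, w1] using he
      clear he
      rcases Nat.lt_succ_iff_lt_or_eq.1 he' with he | rfl
      · have := hI e he
        have hne := he.ne
        simp only [List.foldl, Instr.step, Instr.apply]
        simp only [segmentAt] at this ⊢
        simpa [hne] using this
      · simp only [List.foldl, Instr.step, Instr.apply]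
        simp [segmentAt, w2, w4, w5]
  · simp
  · rintro s' hu ⟨⟨v, hv, hI⟩, hlt⟩
    have w3 : s'.nreg 0 = s.nreg 0 := by
      rw [hu.nreg _ (by simp [block, Prog.Has, Instr.WritesN])]; simp
    simp only [Test.holds, w3] at hlt
    have : s'.nreg (b + 30) = s.nreg 0 := by omega
    rwa [this] at hI

/-! ### Correctness of the preparation -/

/-- The states agree on what the preparation does not write after `setUp`. -/
structure Keeps (b : ℕ) (s s' : RAMState) : Prop where
  nreg : ∀ r, r < b + 20 ∨ r = b + 27 ∨ r = b + 28 ∨ r = b + 29 → s'.nreg r = s.nreg r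
  rreg : ∀ r < b + 30, s'.rreg r = s.rreg r
  narr : s'.narr = s.narr
  rarr : ∀ A, 8 ≤ A → A < b + 20 → s'.rarr A = s.rarr A
  drawn : s'.drawn = s.drawn

theorem Keeps.trans {b : ℕ} {s s' s'' : RAMState} (h : Keeps b s s') (h' : Keeps b s' s'') :
    Keeps b s s'' :=
  ⟨fun r hr => (h'.nreg r hr).trans (h.nreg r hr), fun r hr => (h'.rreg r hr).trans (h.rreg r hr),
    h'.narr.trans h.narr, fun A h1 h2 => (h'.rarr A h1 h2).trans (h.rarr A h1 h2),
    h'.drawn.trans h.drawn⟩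

theorem Unchanged.keeps {b : ℕ} {p : Prog} {s s' : RAMState} (h : Unchanged p s s')
    (h1 : ∀ r, r < b + 20 ∨ r = b + 27 ∨ r = b + 28 ∨ r = b + 29 → ¬ p.Has (Instr.WritesN r))
    (h2 : ∀ r < b + 30, ¬ p.Has (Instr.WritesR r)) (h3 : ∀ A, ¬ p.Has (Instr.WritesNArr A))
    (h4 : ∀ A, 8 ≤ A → A < b + 20 → ¬ p.Has (Instr.WritesRArr A))
    (h5 : ¬ p.Has Instr.IsRand) : Keeps b s s' :=
  ⟨fun r hr => h.nreg r (h1 r hr), fun r hr => h.rreg r (h2 r hr),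
    funext fun A => h.narr A (h3 A), fun A hA hA' => h.rarr A (h4 A hA hA'), h.drawn h5⟩

theorem Unchanged.keeps_subdivide {b c nr kr d : ℕ} {s s' : RAMState} (hkr : b + 20 ≤ kr)
    (hkr' : kr < b + 27) (hd : b + 20 ≤ d) (h : Unchanged (subdivide b c nr kr d) s s') :
    Keeps b s s' := by
  apply h.keeps <;>
    simp [subdivide, cutPiece, finishPiece, loadSegment, block, Prog.Has, Instr.WritesN,
      Instr.WritesR, Instr.WritesNArr, Instr.WritesRArr, Instr.IsRand] <;> omega

theorem Unchanged.keeps_clearInputs {b : ℕ} {s s' : RAMState}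
    (h : Unchanged (clearInputs b) s s') : Keeps b s s' := by
  apply h.keeps <;>
    simp [clearInputs, block, Prog.Has, Instr.WritesN,
      Instr.WritesR, Instr.WritesNArr, Instr.WritesRArr, Instr.IsRand] <;> omega

theorem Unchanged.keeps_copyPoints {b c d kr : ℕ} {s s' : RAMState} (hd : d ≤ 5)
    (h : Unchanged (copyPoints b c d kr) s s') : Keeps b s s' := by
  apply h.keeps <;>
    simp [copyPoints, block, Prog.Has, Instr.WritesN,
      Instr.WritesR, Instr.WritesNArr, Instr.WritesRArr, Instr.IsRand] <;> omega

theorem within_setUp (b : ℕ) (s : RAMState) :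
    Within (setUp b) s 9 fun s' => s'.nreg (b + 28) = 1 ∧
      s'.nreg (b + 27) = s.nreg 0 + s.nreg 1 ∧
      s'.rreg (b + 20) = s.rreg 0 / ((1 + s.rreg 0) * ((s.nreg 0 : ℝ) * s.nreg 1)) := by
  refine (Within.block (by simp [Instr.step, Instr.apply]) s).mono (by simp) ?_
  rintro s' - rfl
  simp [Instr.step, Instr.apply]

/-- `Q` arises from `P` by cutting the segments into pieces of length at most `g`. -/
structure Refines (g : ℝ) {n k : ℕ} (P : Fin n → Seg) (Q : Fin k → Seg) : Prop where
  le_card : n ≤ k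
  card_le : k ≤ n + ⌈1 / g⌉₊
  pos : ∀ q, 0 < (Q q).len
  len_le : ∀ q, (Q q).len ≤ g
  measure_eq : lengthMeasure Q = lengthMeasure P

theorem Refines.sum_len {g : ℝ} {n k : ℕ} {P : Fin n → Seg} {Q : Fin k → Seg}
    (h : Refines g P Q) (hP : IsUnitFamily P) : ∑ q, (Q q).len = 1 := by
  have e := congrArg (· Set.univ) h.measure_eq
  simp only [lengthMeasure_univ] at e
  rwa [ENNReal.ofReal_eq_ofReal_iff (Finset.sum_nonneg fun q _ => (Q q).len_nonneg)
    (Finset.sum_nonneg fun q _ => (P q).len_nonneg), hP.2] at e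

/-- Pieces of length at most `g` that add up to length one number at least `1/g`. Together with
`le_card` this bounds the work of the preparation by a multiple of the number of pieces. -/
theorem Refines.ceil_le {g : ℝ} (hg : 0 < g) {n k : ℕ} {P : Fin n → Seg} {Q : Fin k → Seg}
    (h : Refines g P Q) (hP : IsUnitFamily P) : ⌈1 / g⌉₊ ≤ k := by
  rw [Nat.ceil_le, div_le_iff₀ hg, ← h.sum_len hP]
  exact (Finset.sum_le_sum fun q _ => h.len_le q).trans (by simp)

theorem refines_of_segmentAt {g : ℝ} {n k : ℕ} {P : Fin n → Seg} {c d : ℕ} {s s' : RAMState}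
    (hP : ∀ i : Fin n, segmentAt s c i = P i) (h1 : n ≤ k) (h2 : k ≤ n + ⌈1 / g⌉₊)
    (h3 : ∀ e < k, 0 < (segmentAt s' d e).len ∧ (segmentAt s' d e).len ≤ g)
    (h4 : ∑ e ∈ Finset.range k, (segmentAt s' d e).meas =
      ∑ j ∈ Finset.range n, (segmentAt s c j).meas) :
    Refines g P fun q : Fin k => segmentAt s' d q where
  le_card := h1
  card_le := h2
  pos q := (h3 q q.2).1
  len_le q := (h3 q q.2).2
  measure_eq := by
    rw [lengthMeasure_eq_sum, lengthMeasure_eq_sum]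
    simp only [← hP]
    rw [← Finset.sum_range fun e => (segmentAt s' d e).meas, h4, Finset.sum_range]

theorem plane_ext {x y : Plane} (h0 : x 0 = y 0) (h1 : x 1 = y 1) : x = y := by
  ext i
  fin_cases i
  exacts [h0, h1]

theorem Seg.ext_ends {s s' : Seg} (ha : s.a = s'.a) (hb : s.b = s'.b) : s = s' := by
  cases s
  cases s'
  exact congrArg₂ Seg.mk ha hb

theorem segmentAt_segmentInput_left (δ : ℝ) {n m : ℕ} (P : Fin n → Seg) (S : Fin m → Seg)
    (i : Fin n) : segmentAt (segmentInput δ P S) 0 i = P i := by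
  refine Seg.ext_ends ?_ ?_ <;> refine plane_ext ?_ ?_ <;>
    simp [segmentAt, segmentInput, startState, padArr]

theorem segmentAt_segmentInput_right (δ : ℝ) {n m : ℕ} (P : Fin n → Seg) (S : Fin m → Seg)
    (j : Fin m) : segmentAt (segmentInput δ P S) 4 j = S j := by
  refine Seg.ext_ends ?_ ?_ <;> refine plane_ext ?_ ?_ <;>
    simp [segmentAt, segmentInput, startState, padArr]

theorem segmentInput_rarr_of_le (δ : ℝ) {n m : ℕ} (P : Fin n → Seg) (S : Fin m → Seg) {e : ℕ}
    (he : n + m ≤ e) (A : ℕ) : (segmentInput δ P S).rarr A e = 0 := by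
  have h1 : ¬ e < n := by omega
  have h2 : ¬ e < m := by omega
  simp only [segmentInput, startState]
  split <;> simp [padArr, h1, h2]

theorem segmentInput_rarr_zero (δ : ℝ) {n m : ℕ} (P : Fin n → Seg) (S : Fin m → Seg) {A : ℕ}
    (hA : 8 ≤ A) (e : ℕ) : (segmentInput δ P S).rarr A e = 0 := by
  obtain ⟨A, rfl⟩ := Nat.exists_eq_add_of_le' hA
  rfl

theorem pointInput_rarr_zero (δ : ℝ) {k l : ℕ} (x : Fin k → Plane) (a : Fin k → ℝ)
    (y : Fin l → Plane) (b : Fin l → ℝ) {A : ℕ} (hA : 6 ≤ A) (e : ℕ) :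
    (pointInput δ x a y b).rarr A e = 0 := by
  obtain ⟨A, rfl⟩ := Nat.exists_eq_add_of_le' hA
  rfl

theorem IsUnitFamily.sum_range_len {n : ℕ} {P : Fin n → Seg} (hP : IsUnitFamily P) {s : RAMState}
    {c : ℕ} (h : ∀ i : Fin n, segmentAt s c i = P i) :
    ∑ j ∈ Finset.range n, (segmentAt s c j).len = 1 := by
  rw [Finset.sum_range, ← hP.2]
  exact Finset.sum_congr rfl fun i _ => by rw [h]

/-- After the preparation, `A` cannot tell the state from the point input given by the first end
points and lengths of the pieces, and the pieces themselves are still stored out of its reach. -/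
theorem within_prepare (b : ℕ) {δ : ℝ} (hδ : 0 < δ) {n m : ℕ} {P : Fin n → Seg} {S : Fin m → Seg}
    (hP : IsUnitFamily P) (hS : IsUnitFamily S) {g : ℝ} (hg : g = δ / ((1 + δ) * ((n : ℝ) * m)))
    {V W : ℕ} (hV : V = n + ⌈1 / g⌉₊) (hW : W = m + ⌈1 / g⌉₊) :
    Within (prepare b) (segmentInput δ P S)
      (9 + ((12 + (V * 19 + 1)) + ((12 + (W * 19 + 1)) + ((1 + ((n + m) * 10 + 1)) +
        ((1 + (V * 8 + 1)) + ((1 + (W * 8 + 1)) + 2)))))) fun s =>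
      ∃ (k l : ℕ) (Q : Fin k → Seg) (R : Fin l → Seg), Refines g P Q ∧ Refines g S R ∧
        AgreeBelow (b + 20) (pointInput δ (fun q => (Q q).a) (fun q => (Q q).len)
          (fun r => (R r).a) (fun r => (R r).len)) s ∧
        (∀ q : Fin k, segmentAt s (b + 20) q = Q q) ∧
        (∀ r : Fin l, segmentAt s (b + 25) r = R r) ∧ s.nreg (b + 28) = 1 := by
  have hn := hP.pos
  have hm := hS.pos
  have hg0 : 0 < g := by rw [hg]; positivity
  set s := segmentInput δ P S with hs
  have z1 : ∀ r, 2 ≤ r → s.nreg r = 0 := fun r hr => by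
    simp [hs, segmentInput, startState, show r ≠ 0 by omega, show r ≠ 1 by omega]
  have z2 : ∀ r, 1 ≤ r → s.rreg r = 0 := fun r hr => by
    simp [hs, segmentInput, startState]; omega
  have z3 : s.nreg 0 = n := rfl
  have z4 : s.nreg 1 = m := rfl
  have z5 : s.rreg 0 = δ := rfl
  refine Within.seq (within_setUp b s) ?_
  rintro s₁ hu₁ ⟨a1, a2, a3⟩
  rw [z3, z4, z5, ← hg] at a3
  rw [z3, z4] at a2
  have n1 : ∀ r < b + 20, s₁.nreg r = s.nreg r := fun r hr =>
    hu₁.nreg r (by simp [setUp, block, Prog.Has, Instr.WritesN]; omega)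
  have n2 : s₁.nreg (b + 29) = 0 := by
    rw [hu₁.nreg _ (by simp [setUp, block, Prog.Has, Instr.WritesN]), z1 _ (by omega)]
  have n3 : ∀ r < b + 20, s₁.rreg r = s.rreg r := fun r hr =>
    hu₁.rreg r (by simp [setUp, block, Prog.Has, Instr.WritesR]; omega)
  have n4 : s₁.rreg (b + 29) = 0 := by
    rw [hu₁.rreg _ (by simp [setUp, block, Prog.Has, Instr.WritesR]), z2 _ (by omega)]
  have n5 : s₁.narr = s.narr := funext fun A =>
    hu₁.narr A (by simp [setUp, block, Prog.Has, Instr.WritesNArr])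
  have n6 : s₁.rarr = s.rarr := funext fun A =>
    hu₁.rarr A (by simp [setUp, block, Prog.Has, Instr.WritesRArr])
  have n7 : s₁.drawn = s.drawn := hu₁.drawn (by simp [setUp, block, Prog.Has, Instr.IsRand])
  have p1 : ∀ i : Fin n, segmentAt s₁ 0 i = P i := fun i => by
    rw [← segmentAt_segmentInput_left δ P S i]
    exact segmentAt_congr (fun A _ _ => by rw [n6]) _
  have p2 : ∀ j : Fin m, segmentAt s₁ 4 j = S j := fun j => by
    rw [← segmentAt_segmentInput_right δ P S j]
    exact segmentAt_congr (fun A _ _ => by rw [n6]) _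
  have c1 : s₁.nreg 0 = n := by rw [n1 _ (by omega), z3]
  have c2 : s₁.nreg 1 = m := by rw [n1 _ (by omega), z4]
  have r1 := within_subdivide (b := b) (c := 0) (nr := 0) (kr := b + 24) (d := b + 20) (s := s₁)
    (V := V) (by omega) (by omega) (by omega) (by omega) (by omega) a1 n4 (by rwa [a3])
    (by rwa [c1]) (fun j hj => by
      rw [c1] at hj
      rw [p1 ⟨j, hj⟩]
      exact hP.1 _) (by rw [c1, a3, IsUnitFamily.sum_range_len hP p1, hV])
  refine Within.seq r1 ?_
  rintro s₂ hu₂ ⟨b1, b2, b3, b4⟩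
  rw [c1] at b1 b4
  rw [a3] at b3
  have k₂ : Keeps b s₁ s₂ := hu₂.keeps_subdivide (by omega) (by omega) le_rfl
  have n8 : ∀ A < 8, s₂.rarr A = s₁.rarr A := fun A hA => hu₂.rarr A (by
    simp [subdivide, cutPiece, finishPiece, loadSegment, block, Prog.Has, Instr.WritesRArr]; omega)
  have p3 : ∀ j : Fin m, segmentAt s₂ 4 j = S j := fun j => by
    rw [← p2 j]
    exact segmentAt_congr (fun A _ _ => n8 A (by omega)) _
  have c3 : s₂.nreg 1 = m := by rw [k₂.nreg _ (by omega), c2]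
  have g2 : s₂.rreg (b + 20) = g := by rw [k₂.rreg _ (by omega), a3]
  have r2 := within_subdivide (b := b) (c := 4) (nr := 1) (kr := b + 25) (d := b + 25) (s := s₂)
    (V := W) (by omega) (by omega) (by omega) (by omega) (by omega)
    (by rw [k₂.nreg _ (by omega), a1]) (by rw [k₂.rreg _ (by omega), n4]) (by rwa [g2])
    (by rwa [c3]) (fun j hj => by
      rw [c3] at hj
      rw [p3 ⟨j, hj⟩]
      exact hS.1 _) (by rw [c3, g2, IsUnitFamily.sum_range_len hS p3, hW])
  refine Within.seq r2 ?_
  rintro s₃ hu₃ ⟨d1, d2, d3, d4⟩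
  rw [c3] at d1 d4
  rw [g2] at d3
  have k₃ : Keeps b s₁ s₃ := k₂.trans (hu₃.keeps_subdivide (by omega) (by omega) (by omega))
  have n9 : ∀ A < b + 25, s₃.rarr A = s₂.rarr A := fun A hA => hu₃.rarr A (by
    simp [subdivide, cutPiece, finishPiece, loadSegment, block, Prog.Has, Instr.WritesRArr]; omega)
  have m1 : s₃.nreg (b + 24) = s₂.nreg (b + 24) := hu₃.nreg _ (by
    simp [subdivide, cutPiece, finishPiece, loadSegment, block, Prog.Has, Instr.WritesN])
  have e27 : s₃.nreg (b + 27) = n + m := by rw [k₃.nreg _ (by omega), a2]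
  have r3 := within_clearInputs (b := b) (s := s₃) (by rw [k₃.nreg _ (by omega), a1])
    (by rw [k₃.rreg _ (by omega), n4])
  rw [e27] at r3
  refine Within.seq r3 ?_
  intro s₄ hu₄ h₄
  have k₄ : Keeps b s₁ s₄ := k₃.trans hu₄.keeps_clearInputs
  -- Clearing `n + m` entries is enough, as the input arrays vanish from there on.
  have zero₄ : ∀ A < 8, ∀ e, s₄.rarr A e = 0 := fun A hA e => by
    rw [h₄ A hA e]
    split_ifs with he
    · rfl
    · rw [n9 A (by omega), n8 A hA, n6]
      exact segmentInput_rarr_of_le δ P S (by omega) A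
  have n10 : ∀ A, b + 20 ≤ A → s₄.rarr A = s₃.rarr A := fun A hA => hu₄.rarr A (by
    simp [clearInputs, block, Prog.Has, Instr.WritesRArr]; omega)
  have m2 : ∀ r, r < b + 30 → s₄.nreg r = s₃.nreg r := fun r hr => hu₄.nreg r (by
    simp [clearInputs, block, Prog.Has, Instr.WritesN]; omega)
  have r4 := within_copyPoints (b := b) (c := b + 20) (d := 0) (kr := b + 24) (s := s₄) (by omega)
    (by omega) (by rw [k₄.nreg _ (by omega), a1])
  have m3 : s₄.nreg (b + 24) = s₂.nreg (b + 24) := by rw [m2 _ (by omega), m1]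
  refine Within.seq (r4.mono (T' := 1 + (V * 8 + 1)) (by rw [m3]; omega) fun _ _ h => h) ?_
  rintro s₅ hu₅ ⟨f0, f1, f2⟩
  have k₅ : Keeps b s₁ s₅ := k₄.trans (hu₅.keeps_copyPoints (by omega))
  have n11 : ∀ A, 3 ≤ A → s₅.rarr A = s₄.rarr A := fun A hA => hu₅.rarr A (by
    simp [copyPoints, block, Prog.Has, Instr.WritesRArr]; omega)
  have m4 : ∀ r, r < b + 30 → s₅.nreg r = s₄.nreg r := fun r hr => hu₅.nreg r (by
    simp [copyPoints, block, Prog.Has, Instr.WritesN]; omega)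
  have r5 := within_copyPoints (b := b) (c := b + 25) (d := 3) (kr := b + 25) (s := s₅) (by omega)
    (by omega) (by rw [k₅.nreg _ (by omega), a1])
  have m5 : s₅.nreg (b + 25) = s₃.nreg (b + 25) := by rw [m4 _ (by omega), m2 _ (by omega)]
  refine Within.seq (r5.mono (T' := 1 + (W * 8 + 1)) (by rw [m5]; omega) fun _ _ h => h) ?_
  rintro s₆ hu₆ ⟨g0, g1, g2'⟩
  have k₆ : Keeps b s₁ s₆ := k₅.trans (hu₆.keeps_copyPoints (by omega))
  have n12 : ∀ A, A < 3 ∨ 6 ≤ A → s₆.rarr A = s₅.rarr A := fun A hA => hu₆.rarr A (by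
    simp [copyPoints, block, Prog.Has, Instr.WritesRArr]; omega)
  have m6 : ∀ r, r < b + 30 → s₆.nreg r = s₅.nreg r := fun r hr => hu₆.nreg r (by
    simp [copyPoints, block, Prog.Has, Instr.WritesN]; omega)
  have m7 : s₆.nreg (b + 24) = s₂.nreg (b + 24) := by rw [m6 _ (by omega), m4 _ (by omega), m3]
  have m8 : s₆.nreg (b + 25) = s₃.nreg (b + 25) := by rw [m6 _ (by omega), m5]
  refine (Within.block (by simp [Instr.step, Instr.apply]) s₆).mono (by simp) ?_
  intro s₇ hu₇ h₇
  have n13 : s₇.rarr = s₆.rarr := funext fun A => hu₇.rarr A (by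
    simp [block, Prog.Has, Instr.WritesRArr])
  have arr20 : ∀ A, b + 20 ≤ A → A < b + 25 → s₇.rarr A = s₂.rarr A := fun A h1 h2 => by
    rw [n13, n12 A (by omega), n11 A (by omega), n10 A h1, n9 A h2]
  have arr25 : ∀ A, b + 25 ≤ A → s₇.rarr A = s₃.rarr A := fun A h1 => by
    rw [n13, n12 A (by omega), n11 A (by omega), n10 A (by omega)]
  refine ⟨s₂.nreg (b + 24), s₃.nreg (b + 25), fun q => segmentAt s₂ (b + 20) q,
    fun r => segmentAt s₃ (b + 25) r,
    refines_of_segmentAt p1 b1 (hV ▸ b2) (fun e he => (b3 e he).2) b4,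
    refines_of_segmentAt p3 d1 (hW ▸ d2) (fun e he => (d3 e he).2) d4, ?_,
    fun q => segmentAt_congr (fun A h1 h2 => arr20 A h1 (by omega)) _,
    fun r => segmentAt_congr (fun A h1 h2 => arr25 A h1) _, ?_⟩
  · constructor
    · intro r hr
      have h29 : s₆.nreg (b + 29) = 0 := by rw [k₆.nreg _ (by omega), n2]
      rcases Nat.lt_or_ge r 2 with h2 | h2
      · rw [h₇]
        interval_cases r
        · simp [Instr.step, Instr.apply, h29, m7, pointInput, startState]
        · simp [Instr.step, Instr.apply, h29, m8, pointInput, startState]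
      · have e : s₇.nreg r = s₆.nreg r := hu₇.nreg r (by
          simp [block, Prog.Has, Instr.WritesN]; omega)
        rw [e, k₆.nreg r (by omega), n1 r hr, z1 r h2]
        simp [pointInput, startState, show r ≠ 0 by omega, show r ≠ 1 by omega]
    · intro r hr
      have e : s₇.rreg r = s₆.rreg r := hu₇.rreg r (by
        simp [block, Prog.Has, Instr.WritesR])
      rw [e, k₆.rreg r (by omega), n3 r hr]
      rfl
    · intro A _ e
      have e' : s₇.narr A = s₆.narr A := hu₇.narr A (by
        simp [block, Prog.Has, Instr.WritesNArr])
      rw [e', k₆.narr, n5]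
      rfl
    · intro A hA e
      rw [n13]
      have hW₃ : ∀ e < s₃.nreg (b + 25), s₃.rarr (b + 29) e = (segmentAt s₃ (b + 25) e).len :=
        fun e he => (d3 e he).1
      have hW₂ : ∀ e < s₂.nreg (b + 24), s₂.rarr (b + 24) e = (segmentAt s₂ (b + 20) e).len :=
        fun e he => (b3 e he).1
      rcases Nat.lt_or_ge A 8 with h8 | h8
      · have q0 : ∀ A, b + 20 ≤ A → A < b + 25 → s₄.rarr A = s₂.rarr A := fun A h1 h2 => by
          rw [n10 A h1, n9 A h2]
        have q1 : ∀ A, b + 25 ≤ A → s₅.rarr A = s₃.rarr A := fun A h1 => by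
          rw [n11 A (by omega), n10 A (by omega)]
        interval_cases A
        · rw [n12 0 (by omega), f0, zero₄ 0 (by omega), q0 _ (by omega) (by omega), m3]
          simp [pointInput, startState, padArr, segmentAt]
        · rw [n12 1 (by omega), f1, zero₄ 1 (by omega), q0 _ (by omega) (by omega), m3]
          simp [pointInput, startState, padArr, segmentAt]
        · rw [n12 2 (by omega), f2, zero₄ 2 (by omega), q0 _ (by omega) (by omega), m3]
          simp +contextual [pointInput, startState, padArr, hW₂]
        · rw [g0, n11 3 (by omega), zero₄ 3 (by omega), q1 _ (by omega), m5]
          simp [pointInput, startState, padArr, segmentAt]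
        · rw [g1, n11 4 (by omega), zero₄ 4 (by omega), q1 _ (by omega), m5]
          simp [pointInput, startState, padArr, segmentAt]
        · rw [g2', n11 5 (by omega), zero₄ 5 (by omega), q1 _ (by omega), m5]
          simp +contextual [pointInput, startState, padArr, hW₃]
        · rw [n12 6 (by omega), n11 6 (by omega), zero₄ 6 (by omega)]
          exact (pointInput_rarr_zero _ _ _ _ _ le_rfl e).symm
        · rw [n12 7 (by omega), n11 7 (by omega), zero₄ 7 (by omega)]
          exact (pointInput_rarr_zero _ _ _ _ _ (by omega) e).symm
      · rw [k₆.rarr A h8 hA, n6, pointInput_rarr_zero _ _ _ _ _ (by omega)]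
        exact segmentInput_rarr_zero δ P S h8 e
    · have e : s₇.drawn = s₆.drawn := hu₇.drawn (by simp [block, Prog.Has, Instr.IsRand])
      rw [e, k₆.drawn, n7]
      rfl
  · rw [hu₇.nreg _ (by simp [block, Prog.Has, Instr.WritesN]), k₆.nreg _ (by omega), a1]

/-! ### Correctness of the program for segments -/

/-- All distances between two pieces are within `2g` of that of their first end points, and the
total mass is one, so each passage between the continuous and the discrete problem costs at most
`2g`. -/
theorem planCost_spread_le_of_refines {δ : ℝ} (hδ : 0 < δ) {n m k l : ℕ} {P : Fin n → Seg}
    {S : Fin m → Seg} {Q : Fin k → Seg} {R : Fin l → Seg} (hP : IsUnitFamily P)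
    (hS : IsUnitFamily S) {g : ℝ} (hg : g = δ / ((1 + δ) * ((n : ℝ) * m))) (hQ : Refines g P Q)
    (hR : Refines g S R) {w : Fin k → Fin l → ℝ}
    (hw : IsDiscretePlan (fun q => (Q q).len) (fun r => (R r).len) w)
    (hopt : ∀ w', IsDiscretePlan (fun q => (Q q).len) (fun r => (R r).len) w' →
      discreteCost (fun q => (Q q).a) (fun r => (R r).a) w ≤
        (1 + δ) * discreteCost (fun q => (Q q).a) (fun r => (R r).a) w') :
    planCost (spread Q R w) ≤
      ENNReal.ofReal (1 + δ) * emd (lengthMeasure P) (lengthMeasure S)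
        + ENNReal.ofReal (5 * δ / ((n : ℝ) * m)) := by
  have hn : (0 : ℝ) < n := by exact_mod_cast hP.pos
  have hm : (0 : ℝ) < m := by exact_mod_cast hS.pos
  have hg0 : 0 < g := by rw [hg]; positivity
  have hsum : ∀ w, IsDiscretePlan (fun q => (Q q).len) (fun r => (R r).len) w → ∀ t : ℝ,
      ∑ q, ∑ r, w q r * (dist (Q q).a (R r).a + t) =
        discreteCost (fun q => (Q q).a) (fun r => (R r).a) w + t := by
    intro w hw t
    simp only [mul_add, Finset.sum_add_distrib, ← Finset.sum_mul, hw.row, hQ.sum_len hP,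
      one_mul, discreteCost]
  have hzero : lengthMeasure (Fin.elim0 : Fin 0 → Seg) = 0 := by simp [lengthMeasure]
  have hdist : ∀ q r, ∀ x ∈ (Q q).carrier, ∀ y ∈ (R r).carrier,
      |dist x y - dist (Q q).a (R r).a| ≤ 2 * g := by
    intro q r x hx y hy
    have h1 := ((Q q).dist_le_len hx (Q q).left_mem).trans (hQ.len_le q)
    have h2 := ((R r).dist_le_len hy (R r).left_mem).trans (hR.len_le r)
    have h3 := dist_triangle4 x (Q q).a (R r).a y
    have h4 := dist_triangle4 (Q q).a x y (R r).a
    rw [dist_comm (R r).a] at h3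
    rw [dist_comm (Q q).a x] at h4
    rw [abs_le]
    constructor <;> linarith
  -- Nothing is matched here: `M` and `M'` are empty and `τ = 0`.
  obtain ⟨w₀, hw₀, hc₀⟩ := exists_plan_le_emd (P := P) (S := S) (M := Fin.elim0) (M' := Fin.elim0)
    (Q := Q) (R := R) (τ := 0) (by rw [hzero, zero_add, hQ.measure_eq])
    (by rw [hzero, zero_add, hR.measure_eq]) (by rw [hzero]; exact isTransportPlan_zero)
    (by rw [hQ.sum_len hP, hR.sum_len hS]) (c := fun q r => dist (Q q).a (R r).a + -(2 * g))
    (fun q r x hx y hy => by linarith [(abs_le.1 (hdist q r x hx y hy)).1])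
  rw [hsum w₀ hw₀, planCost, lintegral_zero_measure, add_zero] at hc₀
  have h1 := planCost_spread_le Q R hw.nonneg (c := fun q r => dist (Q q).a (R r).a + 2 * g)
    (fun q r => by positivity)
    (fun q r x hx y hy => by linarith [(abs_le.1 (hdist q r x hx y hy)).2])
  rw [hsum w hw] at h1
  have h2 := hopt w₀ hw₀
  set X := discreteCost (fun q => (Q q).a) (fun r => (R r).a) w₀
  have hε : (1 + δ) * g = δ / ((n : ℝ) * m) := by
    rw [hg]
    field_simp
  refine h1.trans ((ENNReal.ofReal_le_ofReal (q := (1 + δ) * (X + -(2 * g)) +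
    5 * δ / ((n : ℝ) * m)) ?_).trans (ENNReal.ofReal_add_le.trans (add_le_add ?_ le_rfl)))
  -- The additive error is `2g + 2(1 + δ)g`, which is at most `5(1 + δ)g = 5δ / (nm)`.
  · rw [mul_div_assoc, ← hε]
    nlinarith
  · rw [ENNReal.ofReal_mul (by linarith)]
    exact mul_le_mul_right hc₀ _

/-- Each entry contributes to exactly one pair of points, so summing over the entries first or over
the pairs first gives the same. The masses must be nonnegative for `ENNReal.ofReal` to commute with
the sums. -/
theorem segmentOutput_eq_spread {k l : ℕ} {Q : Fin k → Seg} {R : Fin l → Seg} {s s' : RAMState}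
    (h0 : s'.nreg 0 = s.nreg 0)
    (hs : ∀ e < s.nreg 0, s.narr 0 e < k ∧ s.narr 1 e < l ∧ 0 ≤ s.rarr 6 e)
    (hw : ∀ e < s.nreg 0, s'.rarr 16 e = s.rarr 6 e)
    (hQ : ∀ e < s.nreg 0, ∀ q : Fin k, s.narr 0 e = q → segmentAt s' 8 e = Q q)
    (hR : ∀ e < s.nreg 0, ∀ r : Fin l, s.narr 1 e = r → segmentAt s' 12 e = R r) :
    segmentOutput s' = spread Q R (pointOutput s k l) := by
  have key : ∀ q r, ENNReal.ofReal (pointOutput s k l q r) • (Q q).unif.prod (R r).unif =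
      ∑ e ∈ Finset.range (s.nreg 0), if s.narr 0 e = q ∧ s.narr 1 e = r then
        ENNReal.ofReal (s.rarr 6 e) • (Q q).unif.prod (R r).unif else 0 := by
    intro q r
    rw [pointOutput, ENNReal.ofReal_sum_of_nonneg, Finset.sum_smul]
    · refine Finset.sum_congr rfl fun e _ => ?_
      split_ifs <;> simp
    · intro e he
      split_ifs
      · exact (hs e (Finset.mem_range.1 he)).2.2
      · exact le_rfl
  simp only [spread, key]
  rw [segmentOutput, h0, Finset.sum_congr rfl fun q _ => Finset.sum_comm, Finset.sum_comm]
  refine Finset.sum_congr rfl fun e he => ?_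
  have he' := Finset.mem_range.1 he
  obtain ⟨h1, h2, -⟩ := hs e he'
  rw [Finset.sum_eq_single (⟨s.narr 0 e, h1⟩ : Fin k),
    Finset.sum_eq_single (⟨s.narr 1 e, h2⟩ : Fin l)]
  · rw [if_pos ⟨rfl, rfl⟩, hw e he', hQ e he' ⟨_, h1⟩ rfl, hR e he' ⟨_, h2⟩ rfl]
  · intro r _ hr
    exact if_neg fun h => hr (Fin.ext h.2.symm)
  · simp
  · intro q _ hq
    exact Finset.sum_eq_zero fun r _ => if_neg fun h => hq (Fin.ext h.1.symm)
  · simp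

/-- A point of positive weight occurs in some entry. Hence the output of `A`, and with it the time
charged to `A`, is at least as large as each of the two point sets. -/
theorem card_le_of_isDiscretePlan_pointOutput {k l : ℕ} {a : Fin k → ℝ} {b : Fin l → ℝ}
    (ha : ∀ i, 0 < a i) (hb : ∀ j, 0 < b j) {s : RAMState}
    (h : IsDiscretePlan a b (pointOutput s k l)) : k ≤ s.nreg 0 ∧ l ≤ s.nreg 0 := by
  have hex : ∀ (i : Fin k) (j : Fin l), pointOutput s k l i j ≠ 0 →
      ∃ e < s.nreg 0, s.narr 0 e = i ∧ s.narr 1 e = j := by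
    intro i j hij
    obtain ⟨e, he, h⟩ := Finset.exists_ne_zero_of_sum_ne_zero hij
    exact ⟨e, Finset.mem_range.1 he, by by_contra hne; exact h (if_neg hne)⟩
  constructor
  · have hsub : Finset.range k ⊆ (Finset.range (s.nreg 0)).image (s.narr 0) := by
      intro i hi
      have hi := Finset.mem_range.1 hi
      obtain ⟨j, -, hj⟩ := Finset.exists_ne_zero_of_sum_ne_zero
        (f := fun j => pointOutput s k l ⟨i, hi⟩ j) (s := Finset.univ)
        (by rw [h.row]; exact (ha _).ne')
      obtain ⟨e, he, h1, -⟩ := hex _ _ hj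
      exact Finset.mem_image.2 ⟨e, Finset.mem_range.2 he, h1⟩
    simpa using (Finset.card_le_card hsub).trans Finset.card_image_le
  · have hsub : Finset.range l ⊆ (Finset.range (s.nreg 0)).image (s.narr 1) := by
      intro j hj
      have hj := Finset.mem_range.1 hj
      obtain ⟨i, -, hi⟩ := Finset.exists_ne_zero_of_sum_ne_zero
        (f := fun i => pointOutput s k l i ⟨j, hj⟩) (s := Finset.univ)
        (by rw [h.col]; exact (hb _).ne')
      obtain ⟨e, he, -, h1⟩ := hex _ _ hi
      exact Finset.mem_image.2 ⟨e, Finset.mem_range.2 he, h1⟩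
    simpa using (Finset.card_le_card hsub).trans Finset.card_image_le

theorem within_copyOutput_unchanged {b : ℕ} {s : RAMState} (h1 : s.nreg (b + 28) = 1) :
    Within (copyOutput b) s (1 + (s.nreg 0 * 22 + 1)) fun s' => s'.nreg 0 = s.nreg 0 ∧
      ∀ e < s.nreg 0, s'.rarr 16 e = s.rarr 6 e ∧
        segmentAt s' 8 e = segmentAt s (b + 20) (s.narr 0 e) ∧
        segmentAt s' 12 e = segmentAt s (b + 25) (s.narr 1 e) :=
  (within_copyOutput h1).mono le_rfl fun s' hu h =>
    ⟨hu.nreg 0 (by simp [copyOutput, block, Prog.Has, Instr.WritesN]), h⟩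

/-- The point instance to which the program reduces a segment instance. -/
theorem exists_point_instance (A : Prog) {δ : ℝ} (hδ : 0 < δ) {n m : ℕ} {P : Fin n → Seg}
    {S : Fin m → Seg} (hP : IsUnitFamily P) (hS : IsUnitFamily S) {g : ℝ}
    (hg : g = δ / ((1 + δ) * ((n : ℝ) * m))) :
    ∃ (k l : ℕ) (Q : Fin k → Seg) (R : Fin l → Seg), Refines g P Q ∧ Refines g S R ∧
      ∀ (ω : RandomTape) (F T : ℝ), SolvesPoints A ω δ F (fun q => (Q q).a) (fun q => (Q q).len)
        (fun r => (R r).a) (fun r => (R r).len) → (0 < F → 200 * F ≤ T) →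
        SolvesSegments (segmentProgram A) ω δ T
          (ENNReal.ofReal (1 + δ) * emd (lengthMeasure P) (lengthMeasure S)
            + ENNReal.ofReal (5 * δ / ((n : ℝ) * m))) P S := by
  have hg0 : 0 < g := by
    have := hP.pos
    have := hS.pos
    rw [hg]
    positivity
  obtain ⟨s, t, hexec, ht, k, l, Q, R, hQ, hR, hagree, hsQ, hsR, h28⟩ :=
    within_prepare A.bound hδ hP hS hg rfl rfl
  refine ⟨k, l, Q, R, hQ, hR, ?_⟩
  rintro ω F T ⟨sA, tA, hA, htime, hent, hplan, hopt⟩ hT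
  -- The margin of 20 ensures that the places of input and output are covered even if `A` mentions
  -- few registers.
  obtain ⟨σ, hσ, hag⟩ := hA.agreeBelow (b := A.bound + 20) (by omega) hagree
  have hu := hσ.unchanged
  have hN : ∀ r, A.bound ≤ r → ¬ A.Has (Instr.WritesN r) := fun r hr h =>
    (A.lt_bound (fun i hi => i.lt_bound (Or.inl hi)) h).not_ge hr
  have hRA : ∀ r, A.bound ≤ r → ¬ A.Has (Instr.WritesRArr r) := fun r hr h =>
    (A.lt_bound (fun i hi => i.lt_bound (Or.inr (Or.inr (Or.inr hi)))) h).not_ge hr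
  have hseg : ∀ c, A.bound ≤ c → ∀ e, segmentAt σ c e = segmentAt s c e := fun c hc =>
    segmentAt_congr fun r h1 _ => hu.rarr r (hRA r (by omega))
  obtain ⟨s', t', hexec', ht', h0, hout⟩ := within_copyOutput_unchanged (b := A.bound) (s := σ)
    (by rw [hu.nreg _ (hN _ (by omega)), h28])
  have e0 : σ.nreg 0 = sA.nreg 0 := hag.nreg 0 (by omega)
  have e1 : ∀ e, σ.narr 0 e = sA.narr 0 e := hag.narr 0 (by omega)
  have e2 : ∀ e, σ.narr 1 e = sA.narr 1 e := hag.narr 1 (by omega)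
  have e3 : ∀ e, σ.rarr 6 e = sA.rarr 6 e := hag.rarr 6 (by omega)
  rw [e0] at h0 hout ht'
  obtain ⟨hk, hl⟩ := card_le_of_isDiscretePlan_pointOutput hQ.pos hR.pos hplan
  have hspread : segmentOutput s' = spread Q R (pointOutput sA k l) := by
    refine segmentOutput_eq_spread h0 hent (fun e he => by rw [(hout e he).1, e3])
      (fun e he q hq => ?_) (fun e he r hr => ?_)
    · rw [(hout e he).2.1, e1, hq, hseg _ (by omega), hsQ]
    · rw [(hout e he).2.2, e2, hr, hseg _ (by omega), hsR]
  refine ⟨s', t + (tA + t'), .seq (hexec ω) (.seq hσ (hexec' ω)), ?_, ?_, ?_, ?_⟩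
  · have hc1 := hQ.ceil_le hg0 hP
    have hc2 := hR.ceil_le hg0 hS
    have := hQ.le_card
    have := hR.le_card
    have := hP.pos
    -- The counts `V` and `W` of the preparation are at most `2k` and `2l`, and `k`, `l` are at most
    -- the number of entries; preparation, copying and output together then need at most 196 steps
    -- per entry, besides the steps of `A`.
    have hnat : t + (tA + t') + s'.nreg 0 ≤ 200 * (tA + sA.nreg 0) := by omega
    have hpos : 0 < tA + sA.nreg 0 := by omega
    have hF : (0 : ℝ) < F := lt_of_lt_of_le (by exact_mod_cast hpos) htime
    refine le_trans ?_ (hT hF)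
    refine le_trans ?_ (mul_le_mul_of_nonneg_left htime (by norm_num))
    exact_mod_cast hnat
  · intro e he
    rw [h0] at he
    rw [(hout e he).1, e3]
    exact (hent e he).2.2
  · rw [hspread, ← hQ.measure_eq, ← hR.measure_eq]
    exact isTransportPlan_spread Q R hplan
  · rw [hspread]
    exact planCost_spread_le_of_refines hδ hP hS hg hQ hR hplan hopt

/-! ### Number of points, time bound and conclusion -/

theorem card_le_of_refines {δ : ℝ} (hδ : 0 < δ) {n m k l : ℕ} {P : Fin n → Seg}
    {S : Fin m → Seg} {Q : Fin k → Seg} {R : Fin l → Seg} (hn : 0 < n) (hm : 0 < m) {g : ℝ}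
    (hg : g = δ / ((1 + δ) * ((n : ℝ) * m))) (hQ : Refines g P Q) (hR : Refines g S R) :
    ((k + l : ℕ) : ℝ) ≤ 8 * ((n : ℝ) * m / (min δ 1) ^ 2) := by
  have hn' : (1 : ℝ) ≤ n := by exact_mod_cast hn
  have hm' : (1 : ℝ) ≤ m := by exact_mod_cast hm
  have hnm : (1 : ℝ) ≤ n * m := by nlinarith
  have hμ : 0 < min δ 1 := lt_min hδ one_pos
  set μ := min δ 1
  have hμ1 : μ ≤ 1 := min_le_right _ _
  have hμδ : μ ≤ δ := min_le_left _ _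
  have hg0 : 0 < g := by rw [hg]; positivity
  set x := (n : ℝ) * m / μ ^ 2 with hx
  have hx1 : (n : ℝ) * m ≤ x := by
    rw [hx, le_div_iff₀ (by positivity)]
    exact mul_le_of_le_one_right (by linarith) (pow_le_one₀ hμ.le hμ1)
  -- Here `1/g = nm(1 + δ)/δ`, and `(1 + δ)μ² ≤ 2δ` because `μ² ≤ δ` and `μ² ≤ 1`.
  have hgx : 1 / g ≤ 2 * x := by
    have e : 1 / g = n * m * ((1 + δ) / δ) := by rw [hg]; field_simp
    rw [e, hx, mul_div_assoc', div_le_iff₀ hδ, mul_div_assoc', div_mul_eq_mul_div,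
      le_div_iff₀ (by positivity)]
    have h1 : μ ^ 2 ≤ δ := by nlinarith
    have h2 : μ ^ 2 ≤ 1 := pow_le_one₀ hμ.le hμ1
    have : (1 + δ) * μ ^ 2 ≤ 2 * δ := by nlinarith
    nlinarith
  have hceil : ((⌈1 / g⌉₊ : ℕ) : ℝ) ≤ 1 / g + 1 := (Nat.ceil_lt_add_one (by positivity)).le
  have h1 : (k : ℝ) ≤ n + ⌈1 / g⌉₊ := by exact_mod_cast hQ.card_le
  have h2 : (l : ℝ) ≤ m + ⌈1 / g⌉₊ := by exact_mod_cast hR.card_le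
  push_cast
  -- From `n + m ≤ 2nm ≤ 2x` and `2⌈1/g⌉ ≤ 4x + 2 ≤ 6x`.
  nlinarith

/-- Either the constant is inside the argument of `f`, and monotonicity suffices, or `N ≤ 8⌈x⌉` is
reached by three doublings, which cost `D ^ 3`. Positivity of `f N` is available because a run that
succeeds takes positive time. -/
theorem time_bound {f : ℕ → ℝ} (hf : Monotone f) {N : ℕ} {x T : ℝ} (hx : 0 < x)
    (hN : (N : ℝ) ≤ 8 * x)
    (hT : 200 * f ⌈200 * x⌉₊ ≤ T ∨ ∃ D : ℝ, (∀ k, 1 ≤ k → f (2 * k) ≤ D * f k) ∧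
      200 * D ^ 3 * f ⌈x⌉₊ ≤ T) (hpos : 0 < f N) : 200 * f N ≤ T := by
  rcases hT with hT | ⟨D, hD, hT⟩
  · have : f N ≤ f ⌈200 * x⌉₊ := hf (by
      have : (N : ℝ) ≤ ⌈200 * x⌉₊ := (hN.trans (by linarith)).trans (Nat.le_ceil _)
      exact_mod_cast this)
    linarith
  · set K := ⌈x⌉₊
    have hK : 1 ≤ K := Nat.ceil_pos.2 hx
    have hle : N ≤ 2 * (2 * (2 * K)) := by
      have h1 : x ≤ K := Nat.le_ceil x
      have h2 : (N : ℝ) ≤ 8 * K := by linarith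
      have h3 : N ≤ 8 * K := by exact_mod_cast h2
      omega
    have h8 : 0 < f (2 * (2 * (2 * K))) := hpos.trans_le (hf hle)
    -- By one more doubling: `f` is positive at both `8K` and `16K`.
    have hD0 : 0 ≤ D := by
      have h16 := hD (2 * (2 * (2 * K))) (by omega)
      have : 0 < f (2 * (2 * (2 * (2 * K)))) := hpos.trans_le (hf (by omega))
      by_contra hneg
      nlinarith
    have i1 := hD K hK
    have i2 := hD (2 * K) (by omega)
    have i3 := hD (2 * (2 * K)) (by omega)
    calc 200 * f N ≤ 200 * f (2 * (2 * (2 * K))) := by linarith [hf hle]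
      _ ≤ 200 * (D * (D * (D * f K))) := by
        have j1 := mul_le_mul_of_nonneg_left i1 hD0
        have j2 := mul_le_mul_of_nonneg_left (i2.trans j1) hD0
        linarith
      _ = 200 * D ^ 3 * f K := by ring
      _ ≤ T := hT

theorem mainTheorem5 :
    -- the match-and-subdivide construction: it can be carried out with `O(nm/δ²)` points, and
    -- every run of it returns a plan of the stated cost
    (∃ C₀ : ℝ, ∀ (δ : ℝ), 0 < δ → δ ≤ 1 →
      ∀ (n m : ℕ) (P : Fin n → Seg) (S : Fin m → Seg), IsUnitFamily P → IsUnitFamily S →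
        (∃ X : MatchSubdivide δ P S, ((X.numQ + X.numR : ℕ) : ℝ) ≤ C₀ * ((n : ℝ) * m) / δ ^ 2) ∧
        ∀ X : MatchSubdivide δ P S,
          IsTransportPlan (lengthMeasure P) (lengthMeasure S) X.plan ∧
          planCost X.plan ≤
            ENNReal.ofReal (1 + 3 * δ) * emd (lengthMeasure P) (lengthMeasure S)
              + ENNReal.ofReal (5 * δ / ((n : ℝ) * m))) ∧
    -- the algorithm: `c`, `C`, `K` are absolute, and `build A` is the program that uses `A`
    (∃ (c C : ℝ) (K : ℝ → ℝ) (build : Prog → Prog),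
      ∀ (δ : ℝ), 0 < δ →
      ∀ (A : Prog) (f : ℕ → ℝ) (ρ : ℕ → ℝ≥0∞), Monotone f → Antitone ρ →
        IsPointAlgorithm A δ f ρ →
      ∀ (n m : ℕ) (P : Fin n → Seg) (S : Fin m → Seg), IsUnitFamily P → IsUnitFamily S →
        ∀ T : ℝ,
          -- time `O(f(O(nm/δ²)))` for every `f`, and `O(f(nm/δ²))` if `f(2k) = O(f(k))`
          (C * f ⌈C * ((n : ℝ) * m) / (min δ 1) ^ 2⌉₊ ≤ T ∨
            ∃ D : ℝ, (∀ k, 1 ≤ k → f (2 * k) ≤ D * f k) ∧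
              K D * f ⌈((n : ℝ) * m) / (min δ 1) ^ 2⌉₊ ≤ T) →
          tapeMeasure {ω | ¬ SolvesSegments (build A) ω δ T
            (ENNReal.ofReal (1 + c * δ) * emd (lengthMeasure P) (lengthMeasure S)
              + ENNReal.ofReal (5 * δ / ((n : ℝ) * m))) P S} ≤ ρ (n + m)) := by
  refine ⟨⟨10, fun δ hδ hδ1 n m P S hP hS => ⟨exists_matchSubdivide hδ hδ1 hP hS,
    fun X => ⟨X.isTransportPlan, X.planCost_plan_le hδ hδ1 hP⟩⟩⟩,
    1, 200, fun D => 200 * D ^ 3, segmentProgram, ?_⟩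
  intro δ hδ A f ρ hf hρ hA n m P S hP hS T hT
  obtain ⟨k, l, Q, R, hQ, hR, hsolve⟩ := exists_point_instance A hδ hP hS rfl
  have hx : 0 < (n : ℝ) * m / (min δ 1) ^ 2 := by
    have := hP.pos
    have := hS.pos
    have := lt_min hδ one_pos
    positivity
  rw [mul_div_assoc] at hT
  have htime := time_bound hf hx (card_le_of_refines hδ hP.pos hS.pos rfl hQ hR) hT
  have hmeas := hA k l (fun q => (Q q).a) (fun q => (Q q).len) (fun r => (R r).a)
    (fun r => (R r).len) (hP.pos.trans_le hQ.le_card) (hS.pos.trans_le hR.le_card) hQ.pos hR.pos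
    ((hQ.sum_len hP).trans (hR.sum_len hS).symm)
  rw [one_mul]
  -- The point instance is the same for all `ω`, so a tape on which the segment program fails is one
  -- on which `A` fails on that instance. It has at least `n + m` points, and `ρ` is non-increasing.
  refine (measure_mono fun ω hω => ?_).trans (hmeas.trans (hρ (Nat.add_le_add hQ.le_card hR.le_card)))
  rw [Set.mem_ofPred_eq] at hω ⊢
  exact fun hs => hω (hsolve ω _ T hs htime)
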